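/- Let $\mathcal H$ be a complex Hilbert space and let $\rho=\sum_k\lambda_k|\phi_k\rangle\langle\phi_k|$ be a quantum state on $\mathcal H$, where $(\phi_k)$ is an orthonormal family, $\lambda_k\ge 0$ and $\sum_k\lambda_k=1$. Let $X,Y$ be observables, i.e. (possibly unbounded) self-adjoint operators on $\mathcal H$, such that $$[X,Y]=XY-YX=\frac{1}{2\pi i}I\quad\text{on }\mathrm{dom}(XY)\cap\mathrm{dom}(YX),$$ and suppose that every $\phi_k$ lies in $\mathrm{dom}(XY)\cap\mathrm{dom}(YX)$. For $\alpha\in[0,1]$ and $T\in\{X,Y\}$ put $A=\tfrac12(\rho^{\alpha}+\rho^{1-\alpha})$ (with $\rho^0=I$), $T_0=T-\mathrm{Tr}[\rho T]I$, and $$K_{\rho,\alpha}(T)=\tfrac12\mathrm{Tr}\big[(i[A,T_0])^2\big],\qquad L_{\rho,\alpha}(T)=\tfrac12\mathrm{Tr}\big[\{A,T_0\}^2\big],\qquad W_{\rho,\alpha}(T)=\sqrt{K_{\rho,\alpha}(T)\,L_{\rho,\alpha}(T)},$$ where $[\cdot,\cdot]$ is the commutator and $\{\cdot,\cdot\}$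 the anticommutator. Here $\mathrm{Tr}[\rho Z]=\sum_k\lambda_k\langle\phi_k,Z\phi_k\rangle$ for a possibly unbounded $Z$ whose domain contains every $\phi_k$; and for $S=i[A,T_0]$ or $S=\{A,T_0\}$, understood as a sesquilinear form $s(x,y)=\langle x,Sy\rangle$ on $\mathrm{dom}(T)$ (that is, $s(x,y)=i(\langle Ax,T_0y\rangle-\langle T_0x,Ay\rangle)$, respectively $s(x,y)=\langle Ax,T_0y\rangle+\langle T_0x,Ay\rangle$), $\mathrm{Tr}[S^2]\in[0,\infty]$ is the squared Hilbert–Schmidt norm of $S$, i.e. the supremum of $\sum_{i,j}|s(e_i,e_j)|^2$ over finite orthonormal families $(e_i)$ in $\mathrm{dom}(T)$. Then, for every $\alpha\in[0,1]$, as an inequality in $[0,\infty]$, $$W_{\rho,\alpha}(X)\,W_{\rho,\alpha}(Y)\ \ge\ \tfrac14\big|\mathrm{Tr}[\rho[X,Y]]\big|^2 .$$ -/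

import Mathlib

open scoped ENNReal InnerProductSpace

noncomputable section

namespace SkewInformation

variable {H : Type*} [NormedAddCommGroup H] [InnerProductSpace ℂ H]

/-- The product `S T` of two partially defined operators, with its natural domain
`{x ∈ dom T | T x ∈ dom S}`. -/
def opMul (S T : H →ₗ.[ℂ] H) : H →ₗ.[ℂ] H where
  domain :=
    { carrier := {x | ∃ h : x ∈ T.domain, T ⟨x, h⟩ ∈ S.domain}
      zero_mem' := ⟨T.domain.zero_mem, by
        have h : T ⟨0, T.domain.zero_mem⟩ = 0 := T.map_zero
        rw [h]; exact S.domain.zero_mem⟩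
      add_mem' := by
        rintro x y ⟨hx, hx'⟩ ⟨hy, hy'⟩
        refine ⟨T.domain.add_mem hx hy, ?_⟩
        have h : T ⟨x + y, T.domain.add_mem hx hy⟩ = T ⟨x, hx⟩ + T ⟨y, hy⟩ :=
          T.map_add ⟨x, hx⟩ ⟨y, hy⟩
        rw [h]; exact S.domain.add_mem hx' hy'
      smul_mem' := by
        rintro c x ⟨hx, hx'⟩
        refine ⟨T.domain.smul_mem c hx, ?_⟩
        have h : T ⟨c • x, T.domain.smul_mem c hx⟩ = c • T ⟨x, hx⟩ := T.map_smul c ⟨x, hx⟩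
        rw [h]; exact S.domain.smul_mem c hx' }
  toFun :=
    { toFun := fun x => S ⟨T ⟨x.1, x.2.1⟩, x.2.2⟩
      map_add' := fun x y => by
        rw [← S.map_add]
        exact congrArg S (Subtype.ext (T.map_add ⟨x.1, x.2.1⟩ ⟨y.1, y.2.1⟩))
      map_smul' := fun c x => by
        rw [RingHom.id_apply, ← S.map_smul]
        exact congrArg S (Subtype.ext (T.map_smul c ⟨x.1, x.2.1⟩)) }

/-- The commutator `[X, Y] = X Y - Y X`; its domain is `dom (X Y) ∩ dom (Y X)`. -/
def commutator (X Y : H →ₗ.[ℂ] H) : H →ₗ.[ℂ] H := opMul X Y - opMul Y X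

theorem mem_domain_left {X Y : H →ₗ.[ℂ] H} {x : H} (h : x ∈ (commutator X Y).domain) :
    x ∈ X.domain := h.2.1

theorem mem_domain_right {X Y : H →ₗ.[ℂ] H} {x : H} (h : x ∈ (commutator X Y).domain) :
    x ∈ Y.domain := h.1.1

/-- A spectral decomposition `ρ = ∑ k, λ k • |φ k⟩⟨φ k|` of a quantum state `ρ`: the `φ k` are
orthonormal, `λ k ≥ 0` and `∑ k, λ k = 1`. The `φ k` may, but need not, span the kernel of `ρ`. -/
structure SpectralDecomposition (ι : Type*) (ρ : H →L[ℂ] H) where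
  /-- the eigenvalues `λ k` -/
  eigenvalue : ι → ℝ
  /-- the eigenvectors `φ k` -/
  eigenvector : ι → H
  orthonormal : Orthonormal ℂ eigenvector
  nonneg : ∀ k, 0 ≤ eigenvalue k
  hasSum_one : HasSum eigenvalue 1
  hasSum_op : HasSum
    (fun k => (eigenvalue k : ℂ) • InnerProductSpace.rankOne ℂ (eigenvector k) (eigenvector k)) ρ

/-- `Tr[ρ T] = ∑ k, λ k ⟨φ k, T φ k⟩` for a possibly unbounded `T` whose domain contains
every `φ k`. -/
def traceWith {ι : Type*} {ρ : H →L[ℂ] H} (D : SpectralDecomposition ι ρ) (T : H →ₗ.[ℂ] H)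
    (hT : ∀ k, D.eigenvector k ∈ T.domain) : ℂ :=
  ∑' k, (D.eigenvalue k : ℂ) * ⟪D.eigenvector k, T ⟨D.eigenvector k, hT k⟩⟫_ℂ

/-- `T₀ = T - Tr[ρ T] I`, with the same domain as `T`. Where the series for `Tr[ρ T]` does not
converge absolutely, the value of the sum is irrelevant: `L_{ρ,α}(T)` below is then `∞` whatever
multiple of `I` is subtracted, and `K_{ρ,α}(T)` never depends on that multiple. -/
def centered {ι : Type*} {ρ : H →L[ℂ] H} (D : SpectralDecomposition ι ρ) (T : H →ₗ.[ℂ] H)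
    (hT : ∀ k, D.eigenvector k ∈ T.domain) : H →ₗ.[ℂ] H :=
  (-(traceWith D T hT • (LinearMap.id : H →ₗ[ℂ] H))) +ᵥ T

/-- The sesquilinear form `⟨x, i[A, T] y⟩` of `i[A, T] = i(A T - T A)` on `dom T`, for a bounded
self-adjoint `A` and a self-adjoint `T`. -/
def commForm (A : H →L[ℂ] H) (T : H →ₗ.[ℂ] H) (x y : T.domain) : ℂ :=
  Complex.I * (⟪A x, T y⟫_ℂ - ⟪T x, A y⟫_ℂ)

/-- The sesquilinear form `⟨x, {A, T} y⟩` of `{A, T} = A T + T A` on `dom T`, for a bounded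
self-adjoint `A` and a self-adjoint `T`. -/
def anticommForm (A : H →L[ℂ] H) (T : H →ₗ.[ℂ] H) (x y : T.domain) : ℂ :=
  ⟪A x, T y⟫_ℂ + ⟪T x, A y⟫_ℂ

/-- `Tr[S²] ∈ [0, ∞]` for a symmetric operator `S` that is given by its sesquilinear form
`q x y = ⟨x, S y⟩` on a dense subspace `V`: the supremum of `∑ i j, |⟨e i, S (e j)⟩|²` over the
finite orthonormal families in `V`. It is the squared Hilbert-Schmidt norm of `S`, and `∞` if `S`
does not extend to a Hilbert-Schmidt operator. -/
def traceSq {V : Submodule ℂ H} (q : V → V → ℂ) : ℝ≥0∞ :=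
  ⨆ (n : ℕ) (e : Fin n → V) (_ : Orthonormal ℂ (fun i => (e i : H))),
    ∑ i, ∑ j, ‖q (e i) (e j)‖ₑ ^ 2

variable [CompleteSpace H]

/-- The mean `(ρ ^ α + ρ ^ (1 - α)) / 2`, with the powers of the functional calculus
(so that `ρ ^ 0 = I`). -/
def powerMean (ρ : H →L[ℂ] H) (α : ℝ) : H →L[ℂ] H :=
  (2⁻¹ : ℂ) • (ρ ^ α + ρ ^ (1 - α))

/-- `K_{ρ,α}(T) = ½ Tr[(i[(ρ ^ α + ρ ^ (1 - α)) / 2, T₀])²]`. -/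
def skewK {ι : Type*} {ρ : H →L[ℂ] H} (D : SpectralDecomposition ι ρ) (α : ℝ) (T : H →ₗ.[ℂ] H)
    (hT : ∀ k, D.eigenvector k ∈ T.domain) : ℝ≥0∞ :=
  2⁻¹ * traceSq (commForm (powerMean ρ α) (centered D T hT))

/-- `L_{ρ,α}(T) = ½ Tr[{(ρ ^ α + ρ ^ (1 - α)) / 2, T₀}²]`. -/
def skewL {ι : Type*} {ρ : H →L[ℂ] H} (D : SpectralDecomposition ι ρ) (α : ℝ) (T : H →ₗ.[ℂ] H)
    (hT : ∀ k, D.eigenvector k ∈ T.domain) : ℝ≥0∞ :=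
  2⁻¹ * traceSq (anticommForm (powerMean ρ α) (centered D T hT))

/-- `W_{ρ,α}(T) = √(K_{ρ,α}(T) L_{ρ,α}(T))`. -/
def skewW {ι : Type*} {ρ : H →L[ℂ] H} (D : SpectralDecomposition ι ρ) (α : ℝ) (T : H →ₗ.[ℂ] H)
    (hT : ∀ k, D.eigenvector k ∈ T.domain) : ℝ≥0∞ :=
  (skewK D α T hT * skewL D α T hT) ^ (1 / 2 : ℝ)

end SkewInformation

end

open scoped ENNReal InnerProductSpace

namespace SkewInformation

/-! ### Powers of `ρ` acting on its eigenvectors. -/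

section FunctionalCalculus

variable {H : Type*} [NormedAddCommGroup H] [InnerProductSpace ℂ H]

/-! Write A for `powerMean ρ α`, with A φ_k = a_k φ_k. The heart is a mixed bound: the product of
the squared Hilbert–Schmidt norms of i[A, X₀] and {A, Y₀} is at least (2c)², where c = Im⟨Xφ_k,
Yφ_k⟩ = -1/(4π) for every k by the commutation relation. Exchanging X and Y, multiplying the two
bounds and taking a square root gives the theorem.

In the eigenvectors, i[A, X] has entries of modulus |a_j - a_k||X_jk| and {A, Y} has entries of
modulus (a_j + a_k)|Y_jk|. Since Im(X_jk Y_kj) is antisymmetric in j, k, the sum 2 ∑ a_j² Im⟨Xφ_j,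
Yφ_j⟩ equals ∑ (a_j² - a_k²) Im(X_jk Y_kj) when the family is a basis; factoring a_j² - a_k² and
applying Cauchy–Schwarz gives the bound, because ∑ a_j² ≥ ∑ λ_j = 1 by AM-GM
(`le_powerMeanValue_sq`).

With unbounded X and Y only finite subfamilies are usable, and Xφ_j has a part orthogonal to them
(`sq_sum_im_inner_le`, `signed_form_le_traceSq`). Replacing a_j by b_j = max(a_j - ε, 0) absorbs it:
once all finitely many j with a_j > ε are included, A has norm at most ε on the complement
(`sq_sum_max_le_traceSq_mul_traceSq`). For 0 < α < 1, A vanishes on ker ρ and ε → 0 is allowed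
(`le_traceSq_mul_traceSq`).

For α ∈ {0, 1}, A is 1/2 on ker ρ, so ε must exceed 1/2 and the truncated bound only shows that the
mixed products are nonzero. But if L(X) and L(Y) were both finite, X and Y would be everywhere
defined (`domain_eq_top_of_anticomm`), hence bounded, which the commutation relation forbids. So
some L is infinite and the product of the W is ∞. -/

theorem real_mem_spectrum_of_apply_eq_smul {a : H →L[ℂ] H} {v : H} {μ : ℝ} (hv : v ≠ 0)
    (h : a v = (μ : ℂ) • v) : μ ∈ spectrum ℝ a := by
  intro hu
  obtain ⟨u, hu⟩ := hu
  have h0 : (u : H →L[ℂ] H) v = 0 := by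
    rw [hu, _root_.sub_apply, h, Algebra.algebraMap_eq_smul_one]
    simp
  have h1 : ((↑u⁻¹ : H →L[ℂ] H) * (u : H →L[ℂ] H)) v = v := by simp
  rw [mul_apply_eq_comp, h0, map_zero] at h1
  exact hv h1.symm

theorem norm_apply_le_of_hilbertBasis {κ : Type*} (b : HilbertBasis κ ℂ H) {A : H →L[ℂ] H}
    (hA : ∀ x y, ⟪A x, y⟫_ℂ = ⟪x, A y⟫_ℂ) {a : κ → ℝ} (hb : ∀ i, A (b i) = (a i : ℂ) • b i)
    {w : H} {ε : ℝ} (hε : 0 ≤ ε) (h : ∀ i, ⟪b i, w⟫_ℂ ≠ 0 → |a i| ≤ ε) : ‖A w‖ ≤ ε * ‖w‖ := by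
  have h1 := b.hasSum_inner_mul_inner (A w) (A w)
  have h2 := (b.hasSum_inner_mul_inner w w).mul_left ((ε ^ 2 : ℝ) : ℂ)
  have e : ∀ x i, ⟪x, b i⟫_ℂ * ⟪b i, x⟫_ℂ = ((‖⟪b i, x⟫_ℂ‖ ^ 2 : ℝ) : ℂ) := by
    intro x i
    rw [← inner_conj_symm, mul_comm, Complex.mul_conj, Complex.normSq_eq_norm_sq]
  simp only [e, ← Complex.ofReal_mul] at h1 h2
  have h1' := Complex.hasSum_re h1
  have h2' := Complex.hasSum_re h2
  have n : ∀ x : H, (⟪x, x⟫_ℂ).re = ‖x‖ ^ 2 := fun x => inner_self_eq_norm_sq (𝕜 := ℂ) x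
  simp only [Complex.ofReal_re, Complex.re_ofReal_mul, n] at h1' h2'
  have h3 := hasSum_le (fun i => ?_) h1' h2'
  · exact le_of_sq_le_sq (by rwa [mul_pow]) (by positivity)
  · have : ⟪b i, A w⟫_ℂ = (a i : ℂ) * ⟪b i, w⟫_ℂ := by
      rw [← hA, hb, inner_smul_left]; simp
    rw [this, norm_mul, mul_pow]
    by_cases h0 : ⟪b i, w⟫_ℂ = 0
    · simp [h0]
    · gcongr
      simpa using h i h0

variable [CompleteSpace H]

/-- The functional calculus acts on an eigenvector through the value at the eigenvalue. -/
theorem cfc_apply_of_apply_eq_smul {a : H →L[ℂ] H} (ha : IsSelfAdjoint a) {f : ℝ → ℝ}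
    (hf : ContinuousOn f (spectrum ℝ a)) {v : H} {μ : ℝ} (h : a v = (μ : ℂ) • v) :
    cfc f a v = (f μ : ℂ) • v := by
  rcases eq_or_ne v 0 with rfl | hv
  · simp
  have hμ := real_mem_spectrum_of_apply_eq_smul hv h
  rw [cfc_apply f a ha hf]
  have key : ∀ g : C(spectrum ℝ a, ℝ),
      (cfcHom (a := a) ha g : H →L[ℂ] H) v = (g ⟨μ, hμ⟩ : ℂ) • v := by
    -- Both sides are continuous and multiplicative in g, so it suffices to check constants and the
    -- identity, by Stone–Weierstrass.
    intro g
    induction g using ContinuousMap.induction_on_of_compact with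
    | const r =>
      have : (ContinuousMap.const (spectrum ℝ a) r) = algebraMap ℝ C(spectrum ℝ a, ℝ) r := rfl
      rw [this, AlgHomClass.commutes, Algebra.algebraMap_eq_smul_one]
      simp
    | id => rw [cfcHom_id ha]; simpa using h
    | star_id => rw [star_trivial, cfcHom_id ha]; simpa using h
    | add f g hf hg => rw [map_add, _root_.add_apply, hf, hg]; simp [add_smul]
    | mul f g hf hg =>
      rw [map_mul, mul_apply_eq_comp, hg, map_smul, hf, smul_smul]
      simp [mul_comm]
    | frequently f h =>
      refine h.mem_of_closed (isClosed_eq ?_ ?_)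
      · have := cfcHom_continuous (R := ℝ) ha
        fun_prop
      · fun_prop
  exact key _

theorem rpow_apply_of_apply_eq_smul {a : H →L[ℂ] H} (ha : 0 ≤ a) {v : H} {μ : ℝ}
    (h : a v = (μ : ℂ) • v) {α : ℝ} (hα : 0 ≤ α) : (a ^ α) v = ((μ ^ α : ℝ) : ℂ) • v := by
  rw [CFC.rpow_eq_cfc_real ha]
  exact cfc_apply_of_apply_eq_smul ha.isSelfAdjoint
    (Real.continuous_rpow_const hα).continuousOn h

/-- The eigenvalue of `powerMean ρ α` that corresponds to the eigenvalue `t` of `ρ`. -/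
noncomputable def powerMeanValue (α t : ℝ) : ℝ := (t ^ α + t ^ (1 - α)) / 2

theorem powerMean_apply_of_apply_eq_smul {a : H →L[ℂ] H} (ha : 0 ≤ a) {v : H} {μ : ℝ}
    (h : a v = (μ : ℂ) • v) {α : ℝ} (hα : α ∈ Set.Icc (0 : ℝ) 1) :
    powerMean a α v = (powerMeanValue α μ : ℂ) • v := by
  rw [powerMean, _root_.smul_apply, _root_.add_apply,
    rpow_apply_of_apply_eq_smul ha h hα.1,
    rpow_apply_of_apply_eq_smul ha h (sub_nonneg.2 hα.2), ← add_smul, smul_smul, powerMeanValue]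
  congr 1
  push_cast
  ring

theorem powerMean_inner (a : H →L[ℂ] H) (α : ℝ) (x y : H) :
    ⟪powerMean a α x, y⟫_ℂ = ⟪x, powerMean a α y⟫_ℂ := by
  have h : IsSelfAdjoint (powerMean a α) := by
    have h1 : ∀ β : ℝ, IsSelfAdjoint (a ^ β) := fun β => CFC.rpow_nonneg.isSelfAdjoint
    have h2 : IsSelfAdjoint (2⁻¹ : ℂ) := by simp [IsSelfAdjoint]
    exact h2.smul ((h1 α).add (h1 (1 - α)))
  exact h.isSymmetric x y

theorem continuous_powerMeanValue {α : ℝ} (hα : α ∈ Set.Icc (0 : ℝ) 1) :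
    Continuous (powerMeanValue α) :=
  ((Real.continuous_rpow_const hα.1).add
    (Real.continuous_rpow_const (sub_nonneg.2 hα.2))).div_const 2

theorem powerMeanValue_nonneg (α : ℝ) {t : ℝ} (ht : 0 ≤ t) : 0 ≤ powerMeanValue α t := by
  unfold powerMeanValue; positivity

/-- AM-GM: the two powers multiply to t. The case t = 0 is separate because the product rule for
powers needs a positive base. -/
theorem le_powerMeanValue_sq (α : ℝ) {t : ℝ} (ht : 0 ≤ t) : t ≤ powerMeanValue α t ^ 2 := by
  rcases ht.eq_or_lt with rfl | ht'
  · positivity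
  have h : t ^ α * t ^ (1 - α) = t := by rw [← Real.rpow_add ht']; simp
  unfold powerMeanValue
  nlinarith [sq_nonneg (t ^ α - t ^ (1 - α))]

end FunctionalCalculus

/-! ### Consequences of the spectral decomposition of the state. -/

namespace SpectralDecomposition

variable {H : Type*} [NormedAddCommGroup H] [InnerProductSpace ℂ H] {ι : Type*} {ρ : H →L[ℂ] H}

theorem hasSum_apply (D : SpectralDecomposition ι ρ) (x : H) :
    HasSum (fun k => (D.eigenvalue k : ℂ) • ⟪D.eigenvector k, x⟫_ℂ • D.eigenvector k) (ρ x) := by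
  simpa using D.hasSum_op.mapL (ContinuousLinearMap.apply ℂ H x)

theorem apply_eigenvector (D : SpectralDecomposition ι ρ) (k : ι) :
    ρ (D.eigenvector k) = (D.eigenvalue k : ℂ) • D.eigenvector k := by
  have h := hasSum_single (f := fun j => (D.eigenvalue j : ℂ) •
    ⟪D.eigenvector j, D.eigenvector k⟫_ℂ • D.eigenvector j) k (fun j hj => by
      simp [D.orthonormal.2 hj])
  rw [(D.hasSum_apply _).unique h]
  simp [D.orthonormal.1 k]

theorem apply_eq_zero (D : SpectralDecomposition ι ρ) {x : H}
    (hx : ∀ k, ⟪D.eigenvector k, x⟫_ℂ = 0) : ρ x = 0 := by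
  refine (D.hasSum_apply x).unique ?_
  simp [hx, hasSum_zero]

theorem op_nonneg (D : SpectralDecomposition ι ρ) [CompleteSpace H] : 0 ≤ ρ := by
  rw [ContinuousLinearMap.nonneg_iff_isPositive, ContinuousLinearMap.isPositive_iff_complex]
  intro x
  have h := (D.hasSum_apply x).mapL (innerSL ℂ x)
  have e : ∀ k, innerSL ℂ x ((D.eigenvalue k : ℂ) • ⟪D.eigenvector k, x⟫_ℂ • D.eigenvector k) =
      ((D.eigenvalue k * ‖⟪D.eigenvector k, x⟫_ℂ‖ ^ 2 : ℝ) : ℂ) := by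
    intro k
    rw [map_smul, map_smul, innerSL_apply_apply, ← inner_conj_symm x, smul_eq_mul, smul_eq_mul,
      Complex.mul_conj, Complex.normSq_eq_norm_sq]
    push_cast; rfl
  simp only [e, innerSL_apply_apply] at h
  have hre := Complex.hasSum_re h
  have him := Complex.hasSum_im h
  simp only [Complex.ofReal_re, Complex.ofReal_im] at hre him
  have him0 := him.unique hasSum_zero
  have hre0 := hre.nonneg fun k => mul_nonneg (D.nonneg k) (sq_nonneg _)
  rw [← inner_conj_symm (ρ x) x]
  constructor
  · apply Complex.ext
    · simp
    · simp only [Complex.conj_im, him0]; simp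
  · simpa only [RCLike.re_to_complex, Complex.conj_re] using hre0

/-- The eigenvalues are summable, hence tend to 0 along the cofinite filter, and the mean is
continuous at 0. -/
theorem finite_setOf_lt_powerMeanValue (D : SpectralDecomposition ι ρ) {α : ℝ}
    (hα : α ∈ Set.Icc (0 : ℝ) 1) {ε : ℝ} (hε : powerMeanValue α 0 < ε) :
    {k | ε < powerMeanValue α (D.eigenvalue k)}.Finite := by
  have h : Filter.Tendsto (fun k => powerMeanValue α (D.eigenvalue k)) Filter.cofinite
      (nhds (powerMeanValue α 0)) :=
    (continuous_powerMeanValue hα).continuousAt.tendsto.comp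
      D.hasSum_one.summable.tendsto_cofinite_zero
  have h1 := h.eventually_lt_const hε
  refine (Filter.eventually_cofinite.1 h1).subset fun k hk => ?_
  exact not_lt.2 (le_of_lt hk)

theorem norm_powerMean_apply_le [CompleteSpace H] (D : SpectralDecomposition ι ρ) {α : ℝ}
    (hα : α ∈ Set.Icc (0 : ℝ) 1) {ε : ℝ} (hε : powerMeanValue α 0 ≤ ε) {w : H}
    (hw : ∀ k, ε < powerMeanValue α (D.eigenvalue k) → ⟪D.eigenvector k, w⟫_ℂ = 0) :
    ‖powerMean ρ α w‖ ≤ ε * ‖w‖ := by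
  obtain ⟨s, b, hs, hb⟩ := D.orthonormal.toSubtypeRange.exists_hilbertBasis_extension
  have hε0 : 0 ≤ ε := (powerMeanValue_nonneg α le_rfl).trans hε
  have hρ := D.op_nonneg
  have key : ∀ i : s, ∃ a : ℝ, powerMean ρ α (b i) = (a : ℂ) • b i ∧
      (⟪b i, w⟫_ℂ ≠ 0 → |a| ≤ ε) := by
    intro i
    by_cases hi : ∃ k, D.eigenvector k = b i
    · obtain ⟨k, hk⟩ := hi
      refine ⟨_, hk ▸ powerMean_apply_of_apply_eq_smul hρ (D.apply_eigenvector k) hα, fun h => ?_⟩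
      rw [abs_of_nonneg (powerMeanValue_nonneg α (D.nonneg k))]
      by_contra! hlt
      exact h (hk ▸ hw k hlt)
    -- A basis vector added to the φ k lies in ker ρ, so its eigenvalue for the mean is
    -- `powerMeanValue α 0`, at most ε.
    · have h0 : ρ (b i) = ((0 : ℝ) : ℂ) • b i := by
        rw [D.apply_eq_zero]
        · simp
        intro k
        have hk : D.eigenvector k ∈ s := hs ⟨k, rfl⟩
        have : b ⟨_, hk⟩ = D.eigenvector k := by rw [hb]
        rw [← this]
        refine b.orthonormal.2 fun h => hi ⟨k, ?_⟩
        rw [← this, h]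
      refine ⟨_, powerMean_apply_of_apply_eq_smul hρ h0 hα, fun _ => ?_⟩
      rwa [abs_of_nonneg (powerMeanValue_nonneg α le_rfl)]
  choose a ha ha' using key
  exact norm_apply_le_of_hilbertBasis b (powerMean_inner ρ α) ha hε0 ha'

end SpectralDecomposition

/-! ### Orthogonal residuals and the finite Cauchy–Schwarz inequality. -/

section Residual

variable {H : Type*} [NormedAddCommGroup H] [InnerProductSpace ℂ H] {κ : Type*} [Fintype κ]

/-- The component of `w` orthogonal to the orthonormal family `φ`. -/
noncomputable def residual (φ : κ → H) (w : H) : H := w - ∑ k, ⟪φ k, w⟫_ℂ • φ k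

theorem residual_add (φ : κ → H) (v w : H) : residual φ (v + w) = residual φ v + residual φ w := by
  simp only [residual, inner_add_right, add_smul, Finset.sum_add_distrib]
  abel

theorem residual_smul (φ : κ → H) (c : ℂ) (w : H) : residual φ (c • w) = c • residual φ w := by
  simp only [residual, inner_smul_right, mul_smul, smul_sub, Finset.smul_sum]

theorem residual_sub (φ : κ → H) (v w : H) : residual φ (v - w) = residual φ v - residual φ w := by
  simp only [residual, inner_sub_right, sub_smul, Finset.sum_sub_distrib]
  abel

theorem inner_residual_right {φ : κ → H} (hφ : Orthonormal ℂ φ) (k : κ) (w : H) :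
    ⟪φ k, residual φ w⟫_ℂ = 0 := by
  rw [residual, inner_sub_right, hφ.inner_right_fintype, sub_self]

theorem residual_eq_self {φ : κ → H} {w : H} (h : ∀ k, ⟪φ k, w⟫_ℂ = 0) : residual φ w = w := by
  simp [residual, h]

theorem inner_residual_of_orthogonal {φ : κ → H} {v : H} (h : ∀ k, ⟪φ k, v⟫_ℂ = 0) (u : H) :
    ⟪residual φ u, v⟫_ℂ = ⟪u, v⟫_ℂ := by
  simp [residual, h]

theorem inner_eq_sum_add_inner_residual {φ : κ → H} (hφ : Orthonormal ℂ φ) (u v : H) :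
    ⟪u, v⟫_ℂ = ∑ k, ⟪u, φ k⟫_ℂ * ⟪φ k, v⟫_ℂ + ⟪residual φ u, residual φ v⟫_ℂ := by
  rw [inner_residual_of_orthogonal (fun k => inner_residual_right hφ k v)]
  simp only [residual, inner_sub_right, inner_sum, inner_smul_right]
  simp only [mul_comm, add_sub_cancel]

theorem norm_residual_le {φ : κ → H} (hφ : Orthonormal ℂ φ) (w : H) : ‖residual φ w‖ ≤ ‖w‖ := by
  have h := inner_residual_of_orthogonal (fun k => inner_residual_right hφ k w) w
  have h1 : ‖residual φ w‖ ^ 2 ≤ ‖w‖ * ‖residual φ w‖ := by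
    rw [← inner_self_eq_norm_sq (𝕜 := ℂ), h]
    exact re_inner_le_norm _ _
  nlinarith [norm_nonneg (residual φ w), norm_nonneg w]

theorem residual_mem {φ : κ → H} {V : Submodule ℂ H} (hφ : ∀ k, φ k ∈ V) {w : H} (hw : w ∈ V) :
    residual φ w ∈ V :=
  V.sub_mem hw (V.sum_mem fun k _ => V.smul_mem _ (hφ k))

theorem map_residual {φ : κ → H} {A : H →L[ℂ] H} (hA : ∀ x y, ⟪A x, y⟫_ℂ = ⟪x, A y⟫_ℂ)
    {a : κ → ℝ} (ha : ∀ k, A (φ k) = (a k : ℂ) • φ k) (w : H) :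
    A (residual φ w) = residual φ (A w) := by
  simp only [residual, map_sub, map_sum, map_smul, ha, ← hA, inner_smul_left, smul_smul]
  simp [mul_comm]

/-- The imaginary part of `⟪x j, y j⟫`, weighted by `b j ^ 2`, is controlled by the
Hilbert-Schmidt norms of a commutator and of an anticommutator. -/
theorem sq_sum_im_inner_le {φ : κ → H} (hφ : Orthonormal ℂ φ) {x y : κ → H}
    (hx : ∀ j k, ⟪x j, φ k⟫_ℂ = ⟪φ j, x k⟫_ℂ) (hy : ∀ j k, ⟪y j, φ k⟫_ℂ = ⟪φ j, y k⟫_ℂ)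
    (b : κ → ℝ) :
    (2 * ∑ j, b j ^ 2 * (⟪x j, y j⟫_ℂ).im) ^ 2 ≤
      (∑ j, ∑ k, ((b j - b k) * ‖⟪x j, φ k⟫_ℂ‖) ^ 2 +
          2 * ∑ j, (b j * ‖residual φ (x j)‖) ^ 2) *
        (∑ j, ∑ k, ((b j + b k) * ‖⟪y j, φ k⟫_ℂ‖) ^ 2 +
          2 * ∑ j, (b j * ‖residual φ (y j)‖) ^ 2) := by
  set m : κ → κ → ℝ := fun j k => (⟪x j, φ k⟫_ℂ * ⟪φ k, y j⟫_ℂ).im with hm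
  have hanti : ∀ j k, m k j = -m j k := by
    intro j k
    simp only [hm]
    rw [hx k j, ← hy j k, ← inner_conj_symm (φ k) (x j), ← inner_conj_symm (y j) (φ k), ← map_mul,
      Complex.conj_im]
  have hexp : ∀ j, (⟪x j, y j⟫_ℂ).im =
      ∑ k, m j k + (⟪residual φ (x j), residual φ (y j)⟫_ℂ).im := by
    intro j
    rw [inner_eq_sum_add_inner_residual hφ, Complex.add_im, Complex.im_sum]
  -- Antisymmetry of m turns twice the sum of b_j² m_jk into the sum of (b_j² - b_k²) m_jk.
  have hsum : 2 * ∑ j, b j ^ 2 * (⟪x j, y j⟫_ℂ).im =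
      ∑ j, ∑ k, (b j ^ 2 - b k ^ 2) * m j k +
        2 * ∑ j, b j ^ 2 * (⟪residual φ (x j), residual φ (y j)⟫_ℂ).im := by
    have h1 : ∑ j, ∑ k, b k ^ 2 * m j k = -∑ j, ∑ k, b j ^ 2 * m j k := by
      rw [Finset.sum_comm, ← Finset.sum_neg_distrib]
      refine Finset.sum_congr rfl fun j _ => ?_
      rw [← Finset.sum_neg_distrib]
      refine Finset.sum_congr rfl fun k _ => ?_
      rw [hanti j k]; ring
    simp only [hexp, sub_mul, Finset.sum_sub_distrib, mul_add, Finset.sum_add_distrib, h1,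
      Finset.mul_sum]
    ring_nf
    simp only [Finset.sum_mul]
    rw [add_comm]
  -- The residuals are listed twice to produce the factor 2, which later matches a row block and a
  -- column block of a Hilbert–Schmidt matrix.
  let f : (κ × κ) ⊕ (κ ⊕ κ) → ℝ := Sum.elim (fun p => |b p.1 - b p.2| * ‖⟪x p.1, φ p.2⟫_ℂ‖)
    (Sum.elim (fun j => |b j| * ‖residual φ (x j)‖) (fun j => |b j| * ‖residual φ (x j)‖))
  let g : (κ × κ) ⊕ (κ ⊕ κ) → ℝ := Sum.elim (fun p => |b p.1 + b p.2| * ‖⟪y p.1, φ p.2⟫_ℂ‖)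
    (Sum.elim (fun j => |b j| * ‖residual φ (y j)‖) (fun j => |b j| * ‖residual φ (y j)‖))
  have hcs := Finset.sum_mul_sq_le_sq_mul_sq Finset.univ f g
  have hf : ∑ i, f i ^ 2 = ∑ j, ∑ k, ((b j - b k) * ‖⟪x j, φ k⟫_ℂ‖) ^ 2 +
          2 * ∑ j, (b j * ‖residual φ (x j)‖) ^ 2 := by
    simp only [Fintype.sum_sum_type, f, Sum.elim_inl, Sum.elim_inr, Fintype.sum_prod_type, mul_pow,
      sq_abs]
    ring
  have hg : ∑ i, g i ^ 2 = ∑ j, ∑ k, ((b j + b k) * ‖⟪y j, φ k⟫_ℂ‖) ^ 2 +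
          2 * ∑ j, (b j * ‖residual φ (y j)‖) ^ 2 := by
    simp only [Fintype.sum_sum_type, g, Sum.elim_inl, Sum.elim_inr, Fintype.sum_prod_type, mul_pow,
      sq_abs]
    ring
  rw [hf, hg] at hcs
  have habs : |2 * ∑ j, b j ^ 2 * (⟪x j, y j⟫_ℂ).im| ≤ ∑ i, f i * g i := by
    rw [hsum]
    simp only [Fintype.sum_sum_type, f, g, Sum.elim_inl, Sum.elim_inr, Fintype.sum_prod_type]
    refine (abs_add_le _ _).trans (add_le_add ?_ ?_)
    · refine (Finset.abs_sum_le_sum_abs _ _).trans (Finset.sum_le_sum fun j _ => ?_)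
      refine (Finset.abs_sum_le_sum_abs _ _).trans (Finset.sum_le_sum fun k _ => ?_)
      have h2 : |m j k| ≤ ‖⟪x j, φ k⟫_ℂ‖ * ‖⟪y j, φ k⟫_ℂ‖ := by
        rw [norm_inner_symm (y j), ← norm_mul]
        exact Complex.abs_im_le_norm _
      rw [abs_mul, show b j ^ 2 - b k ^ 2 = (b j - b k) * (b j + b k) by ring, abs_mul]
      calc _ ≤ |b j - b k| * |b j + b k| * (‖⟪x j, φ k⟫_ℂ‖ * ‖⟪y j, φ k⟫_ℂ‖) := by gcongr
        _ = _ := by ring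
    · rw [abs_mul, abs_two, two_mul]
      have h3 : |∑ j, b j ^ 2 * (⟪residual φ (x j), residual φ (y j)⟫_ℂ).im| ≤
          ∑ j, |b j| * ‖residual φ (x j)‖ * (|b j| * ‖residual φ (y j)‖) := by
        refine (Finset.abs_sum_le_sum_abs _ _).trans (Finset.sum_le_sum fun j _ => ?_)
        have h4 : |(⟪residual φ (x j), residual φ (y j)⟫_ℂ).im| ≤
            ‖residual φ (x j)‖ * ‖residual φ (y j)‖ :=
          (Complex.abs_im_le_norm _).trans (norm_inner_le_norm _ _)
        rw [abs_mul, abs_pow, sq]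
        calc _ ≤ |b j| * |b j| * (‖residual φ (x j)‖ * ‖residual φ (y j)‖) := by gcongr
          _ = _ := by ring
      exact add_le_add h3 h3
  exact (sq_le_sq' (abs_le.1 habs).1 (abs_le.1 habs).2).trans hcs

end Residual

/-! ### Lower bounds for the Hilbert–Schmidt norm of a form. -/

section TraceSq

variable {H : Type*} [NormedAddCommGroup H] [InnerProductSpace ℂ H] {κ : Type*} [Fintype κ]
  {V : Submodule ℂ H}

theorem sum_enorm_sq_le_traceSq (q : V → V → ℂ) {e : κ → V}
    (he : Orthonormal ℂ fun i => (e i : H)) :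
    ∑ i, ∑ j, ‖q (e i) (e j)‖ₑ ^ 2 ≤ traceSq q := by
  let σ := (Fintype.equivFin κ).symm
  have h : Orthonormal ℂ fun i => (e (σ i) : H) := he.comp σ σ.injective
  refine le_of_eq_of_le ?_ (le_iSup_of_le (Fintype.card κ)
    (le_iSup_of_le (fun i => e (σ i)) (le_iSup_of_le h le_rfl)))
  rw [← Equiv.sum_comp σ]
  exact Finset.sum_congr rfl fun i _ => (Equiv.sum_comp σ (fun j => ‖q (e (σ i)) (e j)‖ₑ ^ 2)).symm

theorem sum_norm_sq_le_traceSq (q : V → V → ℂ) {e : κ → V}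
    (he : Orthonormal ℂ fun i => (e i : H)) :
    ENNReal.ofReal (∑ i, ∑ j, ‖q (e i) (e j)‖ ^ 2) ≤ traceSq q := by
  refine le_of_eq_of_le ?_ (sum_enorm_sq_le_traceSq q he)
  rw [ENNReal.ofReal_sum_of_nonneg fun i _ => Finset.sum_nonneg fun j _ => sq_nonneg _]
  refine Finset.sum_congr rfl fun i _ => ?_
  rw [ENNReal.ofReal_sum_of_nonneg fun i _ => sq_nonneg _]
  refine Finset.sum_congr rfl fun j _ => ?_
  rw [ENNReal.ofReal_pow (norm_nonneg _), ofReal_norm]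

/-- Lower bound for `traceSq` by the rows and columns of an orthonormal family in `V`, up to an
approximation of the residuals by vectors of `V`. -/
theorem sum_max_le_traceSq (hV : Dense (V : Set H)) (q : V → V → ℂ) {φ : κ → V}
    (hφ : Orthonormal ℂ fun i => (φ i : H)) {g : κ → H}
    (hl : ∀ j y, ‖q (φ j) y‖ = ‖⟪g j, (y : H)⟫_ℂ‖) (hr : ∀ j y, ‖q y (φ j)‖ = ‖⟪g j, (y : H)⟫_ℂ‖)
    {δ : ℝ} (hδ : 0 < δ) :
    ENNReal.ofReal (∑ j, ∑ k, ‖⟪g j, (φ k : H)⟫_ℂ‖ ^ 2 +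
      2 * ∑ j, (max (‖residual (fun i => (φ i : H)) (g j)‖ - δ) 0) ^ 2) ≤ traceSq q := by
  set ψ : κ → H := fun i => (φ i : H) with hψ
  -- The residual of g j need not lie in V. Removing the φ-components of a nearby vector of V stays
  -- in V and does not increase the error.
  have hex : ∀ j, ∃ w ∈ V, (∀ k, ⟪ψ k, w⟫_ℂ = 0) ∧ ‖residual ψ (g j) - w‖ ≤ δ := by
    intro j
    obtain ⟨v, hv, hvd⟩ := hV.exists_dist_lt (residual ψ (g j)) hδ
    refine ⟨residual ψ v, residual_mem (fun k => (φ k).2) hv,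
      fun k => inner_residual_right hφ k v, ?_⟩
    have h1 : residual ψ (g j) - residual ψ v = residual ψ (residual ψ (g j) - v) := by
      rw [residual_sub, residual_eq_self (w := residual ψ (g j))
        (fun k => inner_residual_right hφ k _)]
    rw [h1]
    exact (norm_residual_le hφ _).trans ((dist_eq_norm _ _).symm.trans_le hvd.le)
  choose w hwV hwφ hwδ using hex
  let G : Submodule ℂ H := Submodule.span ℂ (Set.range w)
  have hfd : FiniteDimensional ℂ G := FiniteDimensional.span_of_finite ℂ (Set.finite_range w)
  have hGV : G ≤ V := Submodule.span_le.2 (by rintro _ ⟨j, rfl⟩; exact hwV j)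
  have hGφ : ∀ u ∈ G, ∀ k, ⟪ψ k, u⟫_ℂ = 0 := by
    intro u hu k
    have : G ≤ LinearMap.ker (innerₛₗ ℂ (ψ k)) :=
      Submodule.span_le.2 (by rintro _ ⟨j, rfl⟩; exact hwφ j k)
    exact this hu
  let u := stdOrthonormalBasis ℂ G
  let e : κ ⊕ Fin (Module.finrank ℂ G) → V := Sum.elim φ (fun m => ⟨u m, hGV (u m).2⟩)
  have hu : Orthonormal ℂ fun m => (u m : H) :=
    u.orthonormal.comp_linearIsometry G.subtypeₗᵢ
  have he : Orthonormal ℂ fun i => (e i : H) := by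
    refine ⟨?_, ?_⟩
    · rintro (j | m)
      · exact hφ.1 j
      · exact hu.1 m
    · rintro (j | m) (j' | m') h
      · exact hφ.2 (fun h' => h (by rw [h']))
      · exact hGφ _ (u m').2 j
      · change ⟪(u m : H), ψ j'⟫_ℂ = 0
        rw [← inner_conj_symm, hGφ _ (u m).2 j', map_zero]
      · exact hu.2 (fun h' => h (by rw [h']))
  refine le_trans (ENNReal.ofReal_le_ofReal ?_) (sum_norm_sq_le_traceSq q he)
  have hproj : ∀ j, (max (‖residual ψ (g j)‖ - δ) 0) ^ 2 ≤ ∑ m, ‖⟪g j, (u m : H)⟫_ℂ‖ ^ 2 := by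
    intro j
    have h1 : ∑ m, ‖⟪g j, (u m : H)⟫_ℂ‖ ^ 2 = ‖G.orthogonalProjectionOnto (residual ψ (g j))‖ ^ 2 := by
      rw [← u.sum_sq_norm_inner_right]
      refine Finset.sum_congr rfl fun m _ => ?_
      rw [Submodule.inner_orthogonalProjectionOnto_eq_of_mem_left, norm_inner_symm (u m : H),
        inner_residual_of_orthogonal (hGφ _ (u m).2)]
    rw [h1]
    have h2 : ‖residual ψ (g j)‖ - δ ≤ ‖G.orthogonalProjectionOnto (residual ψ (g j))‖ := by
      have h3 : ‖residual ψ (g j) - G.starProjection (residual ψ (g j))‖ ≤ δ := by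
        refine le_trans ?_ (hwδ j)
        rw [G.starProjection_minimal]
        exact ciInf_le ⟨0, by rintro _ ⟨_, rfl⟩; positivity⟩
          (⟨w j, Submodule.subset_span ⟨j, rfl⟩⟩ : G)
      have h4 := norm_sub_norm_le (residual ψ (g j)) (G.starProjection (residual ψ (g j)))
      have h5 : ‖G.starProjection (residual ψ (g j))‖ =
        ‖G.orthogonalProjectionOnto (residual ψ (g j))‖ := rfl
      linarith
    have := max_le h2 (norm_nonneg _)
    gcongr
  have hsplit : ∑ i, ∑ j, ‖q (e i) (e j)‖ ^ 2 = ∑ j, ∑ k, ‖⟪g j, (φ k : H)⟫_ℂ‖ ^ 2 +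
      2 * ∑ j, ∑ m, ‖⟪g j, (u m : H)⟫_ℂ‖ ^ 2 +
      ∑ m, ∑ m', ‖q ⟨u m, hGV (u m).2⟩ ⟨u m', hGV (u m').2⟩‖ ^ 2 := by
    simp only [Fintype.sum_sum_type, e, Sum.elim_inl, Sum.elim_inr, hl, hr,
      Finset.sum_add_distrib]
    rw [Finset.sum_comm (s := (Finset.univ : Finset (Fin (Module.finrank ℂ G))))
      (t := (Finset.univ : Finset κ))]
    have hs : ∑ j, ∑ k, ‖⟪g k, (φ j : H)⟫_ℂ‖ ^ 2 = ∑ j, ∑ k, ‖⟪g j, (φ k : H)⟫_ℂ‖ ^ 2 :=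
      Finset.sum_comm
    rw [hs]
    ring
  rw [hsplit]
  -- The block of q on G × G is discarded; the φ × G and G × φ blocks supply the factor 2.
  have hlast : 0 ≤ ∑ m, ∑ m', ‖q ⟨u m, hGV (u m).2⟩ ⟨u m', hGV (u m').2⟩‖ ^ 2 := by positivity
  have := Finset.sum_le_sum fun j (_ : j ∈ Finset.univ) => hproj j
  linarith

theorem sum_add_residual_le_traceSq (hV : Dense (V : Set H)) (q : V → V → ℂ) {φ : κ → V}
    (hφ : Orthonormal ℂ fun i => (φ i : H)) {g : κ → H}
    (hl : ∀ j y, ‖q (φ j) y‖ = ‖⟪g j, (y : H)⟫_ℂ‖)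
    (hr : ∀ j y, ‖q y (φ j)‖ = ‖⟪g j, (y : H)⟫_ℂ‖) :
    ENNReal.ofReal (∑ j, ∑ k, ‖⟪g j, (φ k : H)⟫_ℂ‖ ^ 2 +
      2 * ∑ j, ‖residual (fun i => (φ i : H)) (g j)‖ ^ 2) ≤ traceSq q := by
  have hc : Continuous fun δ : ℝ => ENNReal.ofReal (∑ j, ∑ k, ‖⟪g j, (φ k : H)⟫_ℂ‖ ^ 2 +
      2 * ∑ j, (max (‖residual (fun i => (φ i : H)) (g j)‖ - δ) 0) ^ 2) := by
    refine ENNReal.continuous_ofReal.comp ?_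
    fun_prop
  have ht := (hc.tendsto 0).mono_left (nhdsWithin_le_nhds (s := Set.Ioi 0))
  simp only [sub_zero, max_eq_left (norm_nonneg _)] at ht
  refine le_of_tendsto ht ?_
  filter_upwards [self_mem_nhdsWithin] with δ hδ
  exact sum_max_le_traceSq hV q hφ hl hr hδ

end TraceSq

/-! ### Commutator and anticommutator forms on eigenvectors. -/

section Forms

variable {H : Type*} [NormedAddCommGroup H] [InnerProductSpace ℂ H] {κ : Type*} [Fintype κ]

/-- Lower bound for the squared Hilbert-Schmidt norm of `A S + σ S A` where `σ = ± 1`, in terms of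
eigenvectors `φ k` of `A`. -/
theorem signed_form_le_traceSq {A : H →L[ℂ] H} (hA : ∀ x y, ⟪A x, y⟫_ℂ = ⟪x, A y⟫_ℂ)
    {S : H →ₗ.[ℂ] H} (hS : S.IsFormalAdjoint S) (hd : Dense (S.domain : Set H))
    {φ : κ → S.domain} (hφ : Orthonormal ℂ fun k => (φ k : H)) {a b : κ → ℝ}
    (ha : ∀ k, A (φ k) = (a k : ℂ) • (φ k : H)) {σ : ℝ} (hσ : σ * σ = 1)
    {q : S.domain → S.domain → ℂ}
    (hq : ∀ x y, ‖q x y‖ = ‖⟪A x, S y⟫_ℂ + (σ : ℂ) * ⟪S x, A y⟫_ℂ‖)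
    (hb : ∀ j k, |b j + σ * b k| ≤ |a j + σ * a k|)
    (hw : ∀ j w, (∀ k, ⟪(φ k : H), w⟫_ℂ = 0) →
      |b j| * ‖w‖ ≤ ‖(a j : ℂ) • w + (σ : ℂ) • A w‖) :
    ENNReal.ofReal (∑ j, ∑ k, ((b j + σ * b k) * ‖⟪S (φ j), (φ k : H)⟫_ℂ‖) ^ 2 +
      2 * ∑ j, (b j * ‖residual (fun k => (φ k : H)) (S (φ j))‖) ^ 2) ≤ traceSq q := by
  -- The vector g j represents the form with one argument φ j: q (φ j) y is ⟨g j, y⟩ up to a phase,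
  -- and so is q y (φ j) up to conjugation, since σ² = 1.
  set g : κ → H := fun j => (a j : ℂ) • S (φ j) + (σ : ℂ) • A (S (φ j)) with hg
  have hin : ∀ j (y : H), ⟪g j, y⟫_ℂ =
      (a j : ℂ) * ⟪S (φ j), y⟫_ℂ + (σ : ℂ) * ⟪S (φ j), A y⟫_ℂ := by
    intro j y
    simp only [hg, inner_add_left, inner_smul_left, Complex.conj_ofReal, hA]
  have hl : ∀ j y, ‖q (φ j) y‖ = ‖⟪g j, (y : H)⟫_ℂ‖ := by
    intro j y
    rw [hq, hin, ha, inner_smul_left, Complex.conj_ofReal, hS]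
  have hσn : ‖(σ : ℂ)‖ = 1 := by
    rw [Complex.norm_real, Real.norm_eq_abs]
    rcases mul_self_eq_one_iff.1 hσ with h | h <;> simp [h]
  have hr : ∀ j y, ‖q y (φ j)‖ = ‖⟪g j, (y : H)⟫_ℂ‖ := by
    intro j y
    have h1 : ⟪A y, S (φ j)⟫_ℂ + (σ : ℂ) * ⟪S y, A (φ j)⟫_ℂ =
        (σ : ℂ) * (starRingEnd ℂ) ⟪g j, (y : H)⟫_ℂ := by
      have hσ' : (σ : ℂ) * σ = 1 := by exact_mod_cast hσ
      rw [hin, map_add, map_mul, map_mul, inner_conj_symm, inner_conj_symm, Complex.conj_ofReal,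
        Complex.conj_ofReal, ha, inner_smul_right, hS]
      linear_combination -⟪A (y : H), S (φ j)⟫_ℂ * hσ'
    rw [hq, h1, norm_mul, hσn, one_mul, RCLike.norm_conj]
  refine le_trans (ENNReal.ofReal_le_ofReal ?_) (sum_add_residual_le_traceSq hd q hφ hl hr)
  refine add_le_add (Finset.sum_le_sum fun j _ => Finset.sum_le_sum fun k _ => ?_)
    (mul_le_mul_of_nonneg_left (Finset.sum_le_sum fun j _ => ?_) zero_le_two)
  · have h1 : ‖⟪g j, (φ k : H)⟫_ℂ‖ = |a j + σ * a k| * ‖⟪S (φ j), (φ k : H)⟫_ℂ‖ := by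
      rw [hin, ha, inner_smul_right, ← Real.norm_eq_abs, ← Complex.norm_real, ← norm_mul]
      congr 1
      push_cast; ring
    rw [h1, mul_pow, mul_pow, sq_abs]
    exact mul_le_mul_of_nonneg_right (sq_le_sq.2 (hb j k)) (sq_nonneg _)
  · have h1 : residual (fun k => (φ k : H)) (g j) =
        (a j : ℂ) • residual (fun k => (φ k : H)) (S (φ j)) +
          (σ : ℂ) • A (residual (fun k => (φ k : H)) (S (φ j))) := by
      rw [hg, residual_add, residual_smul, residual_smul, map_residual hA ha]
    have h2 := hw j _ fun k => inner_residual_right hφ k (S (φ j))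
    rw [h1, mul_pow, ← sq_abs (b j), ← mul_pow]
    gcongr

/-- Uncertainty inequality between `i[A, X]` and `{A, Y}` in terms of eigenvectors of `A`. -/
theorem sq_sum_im_le_traceSq_mul_traceSq {A : H →L[ℂ] H}
    (hA : ∀ x y, ⟪A x, y⟫_ℂ = ⟪x, A y⟫_ℂ) {X Y : H →ₗ.[ℂ] H} (hX : X.IsFormalAdjoint X)
    (hdX : Dense (X.domain : Set H)) (hY : Y.IsFormalAdjoint Y) (hdY : Dense (Y.domain : Set H))
    {φ : κ → H} (hφ : Orthonormal ℂ φ) (hφX : ∀ k, φ k ∈ X.domain) (hφY : ∀ k, φ k ∈ Y.domain)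
    {a b : κ → ℝ} (ha : ∀ k, A (φ k) = (a k : ℂ) • φ k)
    (hb : ∀ j k, |b j - b k| ≤ |a j - a k|) (hb' : ∀ j k, |b j + b k| ≤ |a j + a k|)
    (hw : ∀ j w, b j ≠ 0 → (∀ k, ⟪φ k, w⟫_ℂ = 0) → |b j| * ‖w‖ + ‖A w‖ ≤ a j * ‖w‖) :
    ENNReal.ofReal ((2 * ∑ j, b j ^ 2 * (⟪X ⟨φ j, hφX j⟩, Y ⟨φ j, hφY j⟩⟫_ℂ).im) ^ 2) ≤
      traceSq (commForm A X) * traceSq (anticommForm A Y) := by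
  have h1 := signed_form_le_traceSq hA hX hdX (φ := fun k => ⟨φ k, hφX k⟩) hφ (b := b) ha
    (σ := -1) (by norm_num) (q := commForm A X)
    (fun x y => by
      rw [commForm, norm_mul, Complex.norm_I, one_mul]
      push_cast
      rw [neg_one_mul, ← sub_eq_add_neg])
    (fun j k => by simpa [sub_eq_add_neg] using hb j k)
    (fun j w h => by
      by_cases hbj : b j = 0
      · simp [hbj]
      have h2 := hw j w hbj h
      have h3 := norm_sub_norm_le ((a j : ℂ) • w) (A w)
      rw [norm_smul, Complex.norm_real, Real.norm_eq_abs] at h3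
      have h4 := mul_le_mul_of_nonneg_right (le_abs_self (a j)) (norm_nonneg w)
      have h5 : (a j : ℂ) • w + ((-1 : ℝ) : ℂ) • A w = (a j : ℂ) • w - A w := by
        simp [sub_eq_add_neg]
      rw [h5]
      linarith)
  have h2 := signed_form_le_traceSq hA hY hdY (φ := fun k => ⟨φ k, hφY k⟩) hφ (b := b) ha
    (σ := 1) (by norm_num) (q := anticommForm A Y)
    (fun x y => by simp [anticommForm])
    (fun j k => by simpa using hb' j k)
    (fun j w h => by
      by_cases hbj : b j = 0
      · simp [hbj]
      have h2 := hw j w hbj h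
      have h3 := norm_sub_le_norm_add ((a j : ℂ) • w) (A w)
      rw [norm_smul, Complex.norm_real, Real.norm_eq_abs] at h3
      have h4 := mul_le_mul_of_nonneg_right (le_abs_self (a j)) (norm_nonneg w)
      rw [Complex.ofReal_one, one_smul]
      linarith)
  refine le_trans ?_ (mul_le_mul' h1 h2)
  rw [← ENNReal.ofReal_mul (by positivity)]
  refine ENNReal.ofReal_le_ofReal ?_
  have h3 := sq_sum_im_inner_le hφ (x := fun j => X ⟨φ j, hφX j⟩) (y := fun j => Y ⟨φ j, hφY j⟩)
    (fun j k => hX ⟨φ j, hφX j⟩ ⟨φ k, hφX k⟩) (fun j k => hY ⟨φ j, hφY j⟩ ⟨φ k, hφY k⟩) b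
  simpa [sub_eq_add_neg] using h3

end Forms

/-! ### Centering, the commutation relation and spectral truncation. -/

section Centered

variable {H : Type*} [NormedAddCommGroup H] [InnerProductSpace ℂ H] {ι : Type*} {ρ : H →L[ℂ] H}

theorem centered_apply (D : SpectralDecomposition ι ρ) (T : H →ₗ.[ℂ] H)
    (hT : ∀ k, D.eigenvector k ∈ T.domain) {x : H} (hx : x ∈ (centered D T hT).domain)
    (hx' : x ∈ T.domain) :
    centered D T hT ⟨x, hx⟩ = T ⟨x, hx'⟩ - traceWith D T hT • x := by
  have h : centered D T hT ⟨x, hx⟩ =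
      (-(traceWith D T hT • (LinearMap.id : H →ₗ[ℂ] H))) x + T ⟨x, hx'⟩ :=
    LinearPMap.vadd_apply _ _ _
  rw [h]
  simp [sub_eq_neg_add]

/-- Holds without summability: conjugation commutes with `tsum` in all cases, including its default
value 0. -/
theorem conj_traceWith (D : SpectralDecomposition ι ρ) {T : H →ₗ.[ℂ] H} (hs : T.IsFormalAdjoint T)
    (hT : ∀ k, D.eigenvector k ∈ T.domain) :
    (starRingEnd ℂ) (traceWith D T hT) = traceWith D T hT := by
  rw [traceWith, Complex.conj_tsum]
  refine tsum_congr fun k => ?_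
  rw [map_mul, Complex.conj_ofReal, inner_conj_symm, hs ⟨_, hT k⟩ ⟨_, hT k⟩]

theorem centered_isFormalAdjoint (D : SpectralDecomposition ι ρ) {T : H →ₗ.[ℂ] H}
    (hs : T.IsFormalAdjoint T) (hT : ∀ k, D.eigenvector k ∈ T.domain) :
    (centered D T hT).IsFormalAdjoint (centered D T hT) := by
  rintro ⟨x, hx⟩ ⟨y, hy⟩
  rw [centered_apply D T hT hx hx, centered_apply D T hT hy hy, inner_sub_left, inner_sub_right,
    inner_smul_left, inner_smul_right, conj_traceWith D hs]
  congr 1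
  exact hs ⟨x, hx⟩ ⟨y, hy⟩

/-- The subtracted multiple of I is real and the expectations of X and Y at x are real, so centering
changes the inner product by a real number. -/
theorem im_inner_centered (D : SpectralDecomposition ι ρ) {X Y : H →ₗ.[ℂ] H}
    (hX : X.IsFormalAdjoint X) (hY : Y.IsFormalAdjoint Y)
    (hDX : ∀ k, D.eigenvector k ∈ X.domain) (hDY : ∀ k, D.eigenvector k ∈ Y.domain)
    {x : H} (hxX : x ∈ X.domain) (hxY : x ∈ Y.domain)
    (hxX' : x ∈ (centered D X hDX).domain) (hxY' : x ∈ (centered D Y hDY).domain) :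
    (⟪centered D X hDX ⟨x, hxX'⟩, centered D Y hDY ⟨x, hxY'⟩⟫_ℂ).im =
      (⟪X ⟨x, hxX⟩, Y ⟨x, hxY⟩⟫_ℂ).im := by
  rw [centered_apply D X hDX hxX' hxX, centered_apply D Y hDY hxY' hxY]
  have h1 := Complex.conj_eq_iff_im.1 (conj_traceWith D hX hDX)
  have h2 := Complex.conj_eq_iff_im.1 (conj_traceWith D hY hDY)
  have h3 : (⟪X ⟨x, hxX⟩, x⟫_ℂ).im = 0 := Complex.conj_eq_iff_im.1 (by
    rw [inner_conj_symm]; exact (hX ⟨x, hxX⟩ ⟨x, hxX⟩).symm)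
  have h4 : (⟪x, Y ⟨x, hxY⟩⟫_ℂ).im = 0 := Complex.conj_eq_iff_im.1 (by
    rw [inner_conj_symm]; exact hY ⟨x, hxY⟩ ⟨x, hxY⟩)
  have h5 : (⟪x, x⟫_ℂ).im = 0 := inner_self_im (𝕜 := ℂ) x
  simp only [inner_sub_left, inner_sub_right, inner_smul_left, inner_smul_right, Complex.sub_im,
    Complex.mul_im, Complex.conj_re, Complex.conj_im, h1, h2, h3, h4, h5]
  simp

theorem im_inner_eq_of_commutator {X Y : H →ₗ.[ℂ] H}
    (hX : X.IsFormalAdjoint X) (hY : Y.IsFormalAdjoint Y)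
    (hXY : ∀ x : (commutator X Y).domain,
      commutator X Y x = (1 / (2 * (Real.pi : ℂ) * Complex.I)) • (x : H))
    {x : H} (hx : x ∈ (commutator X Y).domain) (hn : ‖x‖ = 1) :
    (⟪X ⟨x, mem_domain_left hx⟩, Y ⟨x, mem_domain_right hx⟩⟫_ℂ).im = -(1 / (4 * Real.pi)) := by
  have h1 : ⟪X ⟨x, mem_domain_left hx⟩, Y ⟨x, mem_domain_right hx⟩⟫_ℂ -
      ⟪Y ⟨x, mem_domain_right hx⟩, X ⟨x, mem_domain_left hx⟩⟫_ℂ =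
        1 / (2 * (Real.pi : ℂ) * Complex.I) := by
    have h2 := congrArg (fun z => ⟪x, z⟫_ℂ) (hXY ⟨x, hx⟩)
    have h3 : commutator X Y ⟨x, hx⟩ =
      X ⟨Y ⟨x, mem_domain_right hx⟩, hx.1.2⟩ - Y ⟨X ⟨x, mem_domain_left hx⟩, hx.2.2⟩ := rfl
    simp only [h3, inner_sub_right, inner_smul_right, inner_self_eq_norm_sq_to_K, hn] at h2
    rw [hX ⟨x, mem_domain_left hx⟩ ⟨Y ⟨x, mem_domain_right hx⟩, hx.1.2⟩,
      hY ⟨x, mem_domain_right hx⟩ ⟨X ⟨x, mem_domain_left hx⟩, hx.2.2⟩]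
    simpa using h2
  have h4 := congrArg Complex.im h1
  rw [← inner_conj_symm (Y _), Complex.sub_im, Complex.conj_im] at h4
  have h5 : (1 / (2 * (Real.pi : ℂ) * Complex.I)).im = -(1 / (2 * Real.pi)) := by
    have : 1 / (2 * (Real.pi : ℂ) * Complex.I) = ((-(1 / (2 * Real.pi)) : ℝ) : ℂ) * Complex.I := by
      have := Real.pi_ne_zero
      push_cast
      field_simp
      simp
    rw [this]; simp
  rw [h5] at h4
  have h6 : 1 / (4 * Real.pi) = 1 / (2 * Real.pi) / 2 := by ring
  rw [h6]
  linarith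

theorem norm_traceWith_commutator (D : SpectralDecomposition ι ρ) {X Y : H →ₗ.[ℂ] H}
    (hXY : ∀ x : (commutator X Y).domain,
      commutator X Y x = (1 / (2 * (Real.pi : ℂ) * Complex.I)) • (x : H))
    (hD : ∀ k, D.eigenvector k ∈ (commutator X Y).domain) :
    ‖traceWith D (commutator X Y) hD‖ = 1 / (2 * Real.pi) := by
  have h : traceWith D (commutator X Y) hD = 1 / (2 * (Real.pi : ℂ) * Complex.I) := by
    have h1 : HasSum (fun k => (D.eigenvalue k : ℂ)) 1 := by
      simpa using Complex.hasSum_ofReal.2 D.hasSum_one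
    have h2 := h1.mul_right (1 / (2 * (Real.pi : ℂ) * Complex.I))
    rw [one_mul] at h2
    rw [← h2.tsum_eq, traceWith]
    refine tsum_congr fun k => ?_
    rw [hXY ⟨_, hD k⟩, inner_smul_right, inner_self_eq_norm_sq_to_K, D.orthonormal.1 k]
    simp
  rw [h]
  simp [abs_of_pos Real.pi_pos]

/-- The uncertainty inequality truncated at the level `ε` of the spectrum of `powerMean ρ α`. -/
theorem sq_sum_max_le_traceSq_mul_traceSq [CompleteSpace H] (D : SpectralDecomposition ι ρ)
    {X Y : H →ₗ.[ℂ] H} (hX : X.IsFormalAdjoint X) (hdX : Dense (X.domain : Set H))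
    (hY : Y.IsFormalAdjoint Y) (hdY : Dense (Y.domain : Set H))
    (hDX : ∀ k, D.eigenvector k ∈ X.domain) (hDY : ∀ k, D.eigenvector k ∈ Y.domain)
    {c : ℝ} (hc : ∀ k, (⟪X ⟨_, hDX k⟩, Y ⟨_, hDY k⟩⟫_ℂ).im = c)
    {α : ℝ} (hα : α ∈ Set.Icc (0 : ℝ) 1) {ε : ℝ} (hε : powerMeanValue α 0 < ε) (G : Finset ι) :
    ENNReal.ofReal
        ((2 * c * ∑ k ∈ G, max (powerMeanValue α (D.eigenvalue k) - ε) 0 ^ 2) ^ 2) ≤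
      traceSq (commForm (powerMean ρ α) (centered D X hDX)) *
        traceSq (anticommForm (powerMean ρ α) (centered D Y hDY)) := by
  classical
  set a : ι → ℝ := fun k => powerMeanValue α (D.eigenvalue k) with ha
  have ha0 : ∀ k, 0 ≤ a k := fun k => powerMeanValue_nonneg α (D.nonneg k)
  have hε0 : 0 ≤ ε := (powerMeanValue_nonneg α le_rfl).trans hε.le
  -- F must contain every index with a k > ε, so that the mean is bounded by ε on the complement of
  -- the family.
  let F : Finset ι := G ∪ (D.finite_setOf_lt_powerMeanValue hα hε).toFinset
  have hF : ∀ k, ε < a k → k ∈ F := fun k hk => Finset.mem_union_right _ (by simpa using hk)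
  -- The map t ↦ max (t - ε) 0 is 1-Lipschitz and at most t for t ≥ 0, which gives the difference
  -- and sum conditions on b.
  have key := sq_sum_im_le_traceSq_mul_traceSq (powerMean_inner ρ α)
    (centered_isFormalAdjoint D hX hDX) hdX (centered_isFormalAdjoint D hY hDY) hdY
    (φ := fun k : F => D.eigenvector k) (D.orthonormal.comp _ Subtype.val_injective)
    (fun k => hDX k) (fun k => hDY k) (a := fun k => a k) (b := fun k => max (a k - ε) 0)
    (fun k => powerMean_apply_of_apply_eq_smul D.op_nonneg (D.apply_eigenvector k) hα)
    (fun j k => by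
      refine (abs_max_sub_max_le_abs _ _ _).trans_eq ?_
      rw [sub_sub_sub_cancel_right])
    (fun j k => by
      rw [abs_of_nonneg (add_nonneg (le_max_right _ _) (le_max_right _ _)),
        abs_of_nonneg (add_nonneg (ha0 _) (ha0 _))]
      exact add_le_add (max_le (by linarith) (ha0 _)) (max_le (by linarith) (ha0 _)))
    ?_
  · refine le_trans (ENNReal.ofReal_le_ofReal ?_) key
    have h1 : ∀ k : F, (⟪centered D X hDX ⟨D.eigenvector k, hDX k⟩,
        centered D Y hDY ⟨D.eigenvector k, hDY k⟩⟫_ℂ).im = c := fun k => by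
      rw [im_inner_centered D hX hY hDX hDY (hDX k) (hDY k) (hDX k) (hDY k), hc]
    simp only [h1]
    rw [← Finset.sum_mul, Finset.sum_coe_sort F (fun k => max (a k - ε) 0 ^ 2), mul_pow, mul_pow,
      mul_pow, mul_pow, mul_assoc, mul_comm (_ ^ 2) (c ^ 2)]
    have h2 : ∑ k ∈ G, max (a k - ε) 0 ^ 2 ≤ ∑ k ∈ F, max (a k - ε) 0 ^ 2 :=
      Finset.sum_le_sum_of_subset_of_nonneg Finset.subset_union_left fun _ _ _ => sq_nonneg _
    have h3 : 0 ≤ ∑ k ∈ G, max (a k - ε) 0 ^ 2 := Finset.sum_nonneg fun _ _ => sq_nonneg _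
    gcongr
  -- If b j ≠ 0 then b j = a j - ε, and ‖A w‖ ≤ ε‖w‖ fills exactly the gap up to a j ‖w‖.
  · intro j w hj h
    have hlt : 0 < a j - ε := by
      by_contra! hle
      exact hj (max_eq_right hle)
    have h1 := D.norm_powerMean_apply_le hα hε.le fun k hk => h ⟨k, hF k hk⟩
    rw [max_eq_left hlt.le, abs_of_pos hlt]
    linarith

end Centered

/-! ### No bounded canonical pairs (Wielandt's argument). -/

section BoundedCommutator

/-- Bounded operators cannot satisfy the canonical commutation relation. -/
theorem mul_sub_mul_ne_smul_one {B : Type*} [NormedRing B] [NormedAlgebra ℂ B] [Nontrivial B]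
    (x y : B) {c : ℂ} (hc : c ≠ 0) : x * y - y * x ≠ c • (1 : B) := by
  intro h
  have hpow : ∀ n : ℕ, x * y ^ (n + 1) - y ^ (n + 1) * x = (((n + 1 : ℕ) : ℂ) * c) • y ^ n := by
    intro n
    induction n with
    | zero => simpa using h
    | succ n ih =>
      have h1 : x * y ^ (n + 1 + 1) - y ^ (n + 1 + 1) * x =
          (x * y ^ (n + 1) - y ^ (n + 1) * x) * y + y ^ (n + 1) * (x * y - y * x) := by
        simp only [pow_succ, sub_mul, mul_sub, mul_assoc]
        abel
      rw [h1, ih, h, smul_mul_assoc, ← pow_succ, mul_smul_comm, mul_one, ← add_smul]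
      congr 1
      push_cast; ring
  -- By `hpow`, y ^ (n + 1) = 0 would force y ^ n = 0, and so on down to 1 = 0.
  have hne : ∀ n : ℕ, y ^ n ≠ 0 := by
    intro n
    induction n with
    | zero => simp
    | succ n ih =>
      intro h0
      have h1 := hpow n
      rw [h0, mul_zero, zero_mul, sub_zero] at h1
      rcases smul_eq_zero.1 h1.symm with h2 | h2
      · exact (mul_ne_zero (Nat.cast_ne_zero.2 n.succ_ne_zero) hc) h2
      · exact ih h2
  -- Taking norms in `hpow` gives (n + 1)‖c‖ ≤ 2‖x‖‖y‖, which fails for large n.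
  obtain ⟨n, hn⟩ := exists_nat_gt (2 * ‖x‖ * ‖y‖ / ‖c‖)
  have hcp : 0 < ‖c‖ := norm_pos_iff.2 hc
  have hyp : 0 < ‖y ^ n‖ := norm_pos_iff.2 (hne n)
  have h1 := congrArg norm (hpow n)
  have h2 : ‖x * y ^ (n + 1) - y ^ (n + 1) * x‖ ≤ 2 * ‖x‖ * ‖y‖ * ‖y ^ n‖ := by
    have h3 : ‖y ^ (n + 1)‖ ≤ ‖y ^ n‖ * ‖y‖ := by rw [pow_succ]; exact norm_mul_le _ _
    have h4 := norm_mul_le x (y ^ (n + 1))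
    have h5 := norm_mul_le (y ^ (n + 1)) x
    have h6 := mul_le_mul_of_nonneg_left h3 (norm_nonneg x)
    have h7 := norm_sub_le (x * y ^ (n + 1)) (y ^ (n + 1) * x)
    nlinarith
  rw [h1, norm_smul, norm_mul, Complex.norm_natCast] at h2
  have h3 := le_of_mul_le_mul_right h2 hyp
  rw [div_lt_iff₀ hcp] at hn
  push_cast at h3
  nlinarith

end BoundedCommutator

/-! ### Boundedness and domain criteria. -/

section Domain

variable {H : Type*} [NormedAddCommGroup H] [InnerProductSpace ℂ H]

theorem norm_le_of_dense_inner_le {V : Submodule ℂ H} (hV : Dense (V : Set H)) {v : H} {C : ℝ}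
    (hC : 0 ≤ C) (h : ∀ x ∈ V, ‖⟪v, x⟫_ℂ‖ ≤ C * ‖x‖) : ‖v‖ ≤ C := by
  have hcl : IsClosed {x : H | ‖⟪v, x⟫_ℂ‖ ≤ C * ‖x‖} := isClosed_le (by fun_prop) (by fun_prop)
  have hv : v ∈ {x : H | ‖⟪v, x⟫_ℂ‖ ≤ C * ‖x‖} := hcl.closure_subset_iff.2 h (hV v)
  rw [Set.mem_ofPred_eq, inner_self_eq_norm_sq_to_K, norm_pow, RCLike.norm_ofReal, abs_norm, sq] at hv
  rcases (norm_nonneg v).eq_or_lt with h0 | h0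
  · rwa [← h0]
  · exact le_of_mul_le_mul_right hv h0

/-- With a k ≥ 1/2 and A positive, the constant b = 1/2 is admissible: matrix entries get weight 1
and residuals weight 1/2, hence the factor 2. The bound does not depend on the family. -/
theorem sum_norm_sq_le_of_anticomm {κ : Type*} [Fintype κ] {A : H →L[ℂ] H}
    (hA : ∀ x y, ⟪A x, y⟫_ℂ = ⟪x, A y⟫_ℂ) (hpos : ∀ x, 0 ≤ (⟪x, A x⟫_ℂ).re)
    {S : H →ₗ.[ℂ] H} (hS : S.IsFormalAdjoint S) (hd : Dense (S.domain : Set H))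
    (hfin : traceSq (anticommForm A S) ≠ ∞)
    {φ : κ → S.domain} (hφ : Orthonormal ℂ fun k => (φ k : H)) {a : κ → ℝ}
    (ha : ∀ k, A (φ k) = (a k : ℂ) • (φ k : H)) (ha2 : ∀ k, 2⁻¹ ≤ a k) :
    ∑ k, ‖S (φ k)‖ ^ 2 ≤ 2 * (traceSq (anticommForm A S)).toReal := by
  have h := signed_form_le_traceSq hA hS hd hφ (b := fun _ => 2⁻¹) ha (σ := 1) (by norm_num)
    (q := anticommForm A S) (fun x y => by simp [anticommForm])
    (fun j k => by
      have h1 := ha2 j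
      have h2 := ha2 k
      rw [abs_of_nonneg (by norm_num), abs_of_nonneg (by linarith)]
      linarith)
    (fun j w _ => by
      rw [Complex.ofReal_one, one_smul, abs_of_pos (by norm_num)]
      rcases (norm_nonneg w).eq_or_lt with h0 | h0
      · rw [← h0, mul_zero]; positivity
      have h1 := re_inner_le_norm (𝕜 := ℂ) w ((a j : ℂ) • w + A w)
      have h2 : RCLike.re ⟪w, (a j : ℂ) • w + A w⟫_ℂ = a j * ‖w‖ ^ 2 + (⟪w, A w⟫_ℂ).re := by
        rw [inner_add_right, inner_smul_right, map_add, RCLike.re_to_complex, RCLike.re_to_complex,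
          Complex.re_ofReal_mul, ← RCLike.re_to_complex, inner_self_eq_norm_sq]
      rw [h2] at h1
      have h3 := hpos w
      have h4 := mul_le_mul_of_nonneg_right (ha2 j) (sq_nonneg ‖w‖)
      refine le_of_mul_le_mul_left ?_ h0
      linarith)
  rw [ENNReal.ofReal_le_iff_le_toReal hfin] at h
  refine le_trans ?_ (mul_le_mul_of_nonneg_left h zero_le_two)
  have hP : ∀ j, ‖S (φ j)‖ ^ 2 = ∑ k, ‖⟪S (φ j), (φ k : H)⟫_ℂ‖ ^ 2 +
      ‖residual (fun k => (φ k : H)) (S (φ j))‖ ^ 2 := by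
    intro j
    have h1 := congrArg Complex.re (inner_eq_sum_add_inner_residual hφ (S (φ j)) (S (φ j)))
    have n : ∀ x : H, (⟪x, x⟫_ℂ).re = ‖x‖ ^ 2 := fun x => inner_self_eq_norm_sq (𝕜 := ℂ) x
    rw [Complex.add_re, n, n, Complex.re_sum] at h1
    rw [h1]
    congr 1
    refine Finset.sum_congr rfl fun k _ => ?_
    rw [← inner_conj_symm (φ k : H), Complex.mul_conj, Complex.ofReal_re,
      Complex.normSq_eq_norm_sq]
  simp only [hP, Finset.sum_add_distrib, mul_pow, ← Finset.mul_sum]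
  have h1 : 0 ≤ ∑ j, ∑ k, ‖⟪S (φ j), (φ k : H)⟫_ℂ‖ ^ 2 := by positivity
  have h2 : 0 ≤ ∑ j, ‖residual (fun k => (φ k : H)) (S (φ j))‖ ^ 2 := by positivity
  linarith

theorem mem_domain_of_inner_le [CompleteSpace H] {T : H →ₗ.[ℂ] H} (hT : IsSelfAdjoint T) {y : H}
    {C : ℝ} (h : ∀ x : T.domain, ‖⟪y, T x⟫_ℂ‖ ≤ C * ‖(x : H)‖) : y ∈ T.domain := by
  rw [← LinearPMap.isSelfAdjoint_def.1 hT, LinearPMap.mem_adjoint_domain_iff]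
  exact AddMonoidHomClass.continuous_of_bound _ C h

theorem isFormalAdjoint_of_isSelfAdjoint [CompleteSpace H] {T : H →ₗ.[ℂ] H}
    (hT : IsSelfAdjoint T) : T.IsFormalAdjoint T := by
  have h := LinearPMap.adjoint_isFormalAdjoint hT.dense_domain
  rwa [LinearPMap.isSelfAdjoint_def.1 hT] at h

end Domain

/-! ### The endpoint exponents, and the limit for interior ones. -/

section Extreme

variable {H : Type*} [NormedAddCommGroup H] [InnerProductSpace ℂ H] [CompleteSpace H]

/-- If `{A, S}` is Hilbert-Schmidt, where `A` is diagonal in an orthonormal family with eigenvalues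
at least `1 / 2` and equals `1 / 2` on its orthogonal complement, then `S` is everywhere defined. -/
theorem domain_eq_top_of_anticomm {ι : Type*} {A : H →L[ℂ] H}
    (hA : ∀ x y, ⟪A x, y⟫_ℂ = ⟪x, A y⟫_ℂ) (hpos : ∀ x, 0 ≤ (⟪x, A x⟫_ℂ).re)
    {S : H →ₗ.[ℂ] H} (hS : S.IsFormalAdjoint S) (hd : Dense (S.domain : Set H))
    (hmem : ∀ (y : H) (C : ℝ), (∀ x : S.domain, ‖⟪y, S x⟫_ℂ‖ ≤ C * ‖(x : H)‖) → y ∈ S.domain)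
    (hfin : traceSq (anticommForm A S) ≠ ∞)
    {φ : ι → H} (hφ : Orthonormal ℂ φ) (hφS : ∀ k, φ k ∈ S.domain) {a : ι → ℝ}
    (ha : ∀ k, A (φ k) = (a k : ℂ) • φ k) (ha2 : ∀ k, 2⁻¹ ≤ a k)
    (ha0 : ∀ w, (∀ k, ⟪φ k, w⟫_ℂ = 0) → A w = (2⁻¹ : ℂ) • w) : S.domain = ⊤ := by
  set M := 2 * (traceSq (anticommForm A S)).toReal with hM
  have hM0 : 0 ≤ M := by positivity
  set C := √M with hC
  have hC0 : 0 ≤ C := Real.sqrt_nonneg _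
  have hsum : ∀ F : Finset ι, ∑ k ∈ F, ‖S ⟨φ k, hφS k⟩‖ ^ 2 ≤ M := by
    intro F
    have h := sum_norm_sq_le_of_anticomm hA hpos hS hd hfin
      (φ := fun k : F => (⟨φ k, hφS k⟩ : S.domain)) (hφ.comp _ Subtype.val_injective)
      (a := fun k => a k) (fun k => ha k) (fun k => ha2 k)
    rwa [Finset.sum_coe_sort F (fun k => ‖S ⟨φ k, hφS k⟩‖ ^ 2)] at h
  set K : Submodule ℂ H := (Submodule.span ℂ (Set.range φ)).topologicalClosure with hK
  -- On finite combinations of the φ i, Cauchy–Schwarz combines Bessel's inequality with `hsum`; the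
  -- estimate then passes to the closure.
  have hKin : ∀ y ∈ K, ∀ x : S.domain, ‖⟪y, S x⟫_ℂ‖ ≤ C * ‖y‖ * ‖(x : H)‖ := by
    intro y hy x
    have hcl : IsClosed {y : H | ‖⟪y, S x⟫_ℂ‖ ≤ C * ‖y‖ * ‖(x : H)‖} :=
      isClosed_le (by fun_prop) (by fun_prop)
    refine hcl.closure_subset_iff.2 ?_ hy
    intro y hy
    obtain ⟨c, rfl⟩ := (Finsupp.mem_span_range_iff_exists_finsupp).1 hy
    set y := c.sum fun i a => a • φ i with hy
    have hc : ∀ i, c i = ⟪φ i, y⟫_ℂ := fun i => by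
      rw [hy, ← Finsupp.linearCombination_apply, hφ.inner_right_finsupp]
    have hbessel : ∑ i ∈ c.support, ‖c i‖ ^ 2 ≤ ‖y‖ ^ 2 := by
      simp only [hc]
      exact hφ.sum_inner_products_le y
    have h1 : ⟪y, S x⟫_ℂ =
        ∑ i ∈ c.support, (starRingEnd ℂ) (c i) * ⟪S ⟨φ i, hφS i⟩, (x : H)⟫_ℂ := by
      rw [hy, Finsupp.sum, sum_inner]
      refine Finset.sum_congr rfl fun i _ => ?_
      rw [inner_smul_left, hS ⟨φ i, hφS i⟩ x]
    have h2 : ‖⟪y, S x⟫_ℂ‖ ≤ (∑ i ∈ c.support, ‖c i‖ * ‖S ⟨φ i, hφS i⟩‖) * ‖(x : H)‖ := by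
      rw [h1, Finset.sum_mul]
      refine norm_sum_le_of_le _ fun i _ => ?_
      rw [norm_mul, RCLike.norm_conj, mul_assoc]
      exact mul_le_mul_of_nonneg_left (norm_inner_le_norm _ _) (norm_nonneg _)
    have h3 : ∑ i ∈ c.support, ‖c i‖ * ‖S ⟨φ i, hφS i⟩‖ ≤ C * ‖y‖ := by
      refine le_of_sq_le_sq ?_ (by positivity)
      refine (Finset.sum_mul_sq_le_sq_mul_sq _ _ _).trans ?_
      rw [mul_pow, hC, Real.sq_sqrt hM0, mul_comm]
      exact mul_le_mul (hsum _) hbessel (Finset.sum_nonneg fun _ _ => sq_nonneg _) hM0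
    exact h2.trans (mul_le_mul_of_nonneg_right h3 (norm_nonneg _))
  have hKS : ∀ y ∈ K, y ∈ S.domain := fun y hy => hmem y _ (hKin y hy)
  have hKn : ∀ (y : H) (hy : y ∈ K), ‖S ⟨y, hKS y hy⟩‖ ≤ C * ‖y‖ := by
    intro y hy
    refine norm_le_of_dense_inner_le hd (by positivity) fun x hx => ?_
    rw [hS ⟨y, hKS y hy⟩ ⟨x, hx⟩]
    exact hKin y hy ⟨x, hx⟩
  have hperp : ∀ z : S.domain, (∀ k, ⟪φ k, (z : H)⟫_ℂ = 0) → ‖S z‖ ≤ C * ‖(z : H)‖ := by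
    intro z hz
    rcases eq_or_ne (z : H) 0 with h0 | h0
    · have : z = 0 := Subtype.ext h0
      subst this
      simp
    have hn : ‖(z : H)‖ ≠ 0 := norm_ne_zero_iff.2 h0
    -- The normalised z is by itself an eigenvector family of A with eigenvalue 1/2, so the
    -- family-independent bound applies.
    set c : ℂ := ((‖(z : H)‖⁻¹ : ℝ) : ℂ) with hc
    have horth : Orthonormal ℂ fun _ : Unit => ((c • z : S.domain) : H) := by
      refine ⟨fun _ => ?_, fun i j hij => (hij rfl).elim⟩
      rw [Submodule.coe_smul, norm_smul, hc, Complex.norm_real, norm_inv, norm_norm,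
        inv_mul_cancel₀ hn]
    have h := sum_norm_sq_le_of_anticomm hA hpos hS hd hfin (φ := fun _ : Unit => c • z) horth
      (a := fun _ => 2⁻¹)
      (fun _ => by rw [Submodule.coe_smul, map_smul, ha0 _ hz, smul_comm]; push_cast; rfl)
      (fun _ => le_rfl)
    rw [Fintype.sum_unique, LinearPMap.map_smul, norm_smul, hc, Complex.norm_real, norm_inv,
      norm_norm, mul_pow, inv_pow, inv_mul_le_iff₀ (by positivity)] at h
    refine le_of_sq_le_sq ?_ (by positivity)
    rw [mul_pow, hC, Real.sq_sqrt hM0, mul_comm]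
    exact h
  have hbound : ∀ x : S.domain, ‖S x‖ ≤ 2 * C * ‖(x : H)‖ := by
    intro x
    -- Since K lies in the domain, both p and x - p do, and S is bounded on each part.
    set p : H := K.starProjection (x : H) with hp
    have hpK : p ∈ K := K.starProjection_apply_mem _
    have hz : (x : H) - p ∈ S.domain := S.domain.sub_mem x.2 (hKS p hpK)
    have hx : x = ⟨p, hKS p hpK⟩ + ⟨(x : H) - p, hz⟩ := Subtype.ext (by simp)
    have h1 := hKn p hpK
    have h2 := hperp ⟨(x : H) - p, hz⟩ fun k =>
      K.sub_starProjection_mem_orthogonal (x : H) (φ k)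
        (Submodule.le_topologicalClosure _ (Submodule.subset_span ⟨k, rfl⟩))
    have h3 : ‖p‖ ≤ ‖(x : H)‖ := K.norm_starProjection_apply_le _
    have h4 : ‖(x : H) - p‖ ≤ ‖(x : H)‖ := by
      rw [hp, K.starProjection_minimal]
      refine (ciInf_le ⟨0, by rintro _ ⟨_, rfl⟩; positivity⟩ (0 : K)).trans_eq (by simp)
    have h5 : ‖S x‖ ≤ ‖S ⟨p, hKS p hpK⟩‖ + ‖S ⟨(x : H) - p, hz⟩‖ := by
      conv_lhs => rw [hx, LinearPMap.map_add]
      exact norm_add_le _ _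
    have h6 := mul_le_mul_of_nonneg_left h3 hC0
    have h7 := mul_le_mul_of_nonneg_left h4 hC0
    simp only at h2
    linarith
  rw [Submodule.eq_top_iff']
  intro y
  refine hmem y (‖y‖ * (2 * C)) fun x => (norm_inner_le_norm _ _).trans ?_
  rw [mul_assoc]
  exact mul_le_mul_of_nonneg_left (hbound x) (norm_nonneg _)

theorem powerMean_nonneg (a : H →L[ℂ] H) (α : ℝ) (x : H) : 0 ≤ (⟪x, powerMean a α x⟫_ℂ).re := by
  have h : ∀ β : ℝ, 0 ≤ (⟪x, (a ^ β) x⟫_ℂ).re := fun β =>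
    ((ContinuousLinearMap.nonneg_iff_isPositive _).1 (CFC.rpow_nonneg (a := a) (y := β))
      ).re_inner_nonneg_right x
  rw [powerMean, _root_.smul_apply, _root_.add_apply, inner_smul_right, inner_add_right,
    show (2⁻¹ : ℂ) = ((2⁻¹ : ℝ) : ℂ) by push_cast; rfl, Complex.re_ofReal_mul, Complex.add_re]
  have := h α
  have := h (1 - α)
  positivity

theorem powerMeanValue_extreme {α : ℝ} (hα : α = 0 ∨ α = 1) (t : ℝ) :
    powerMeanValue α t = (1 + t) / 2 := by
  rcases hα with rfl | rfl <;> simp [powerMeanValue, add_comm]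

theorem powerMeanValue_zero_of_mem_Ioo {α : ℝ} (hα : α ∈ Set.Ioo (0 : ℝ) 1) :
    powerMeanValue α 0 = 0 := by
  rw [powerMeanValue, Real.zero_rpow hα.1.ne', Real.zero_rpow (sub_pos.2 hα.2).ne']
  simp

variable {ι : Type*} {ρ : H →L[ℂ] H}

theorem domain_eq_top_of_traceSq_ne_top (D : SpectralDecomposition ι ρ) {α : ℝ}
    (hα : α = 0 ∨ α = 1) {T : H →ₗ.[ℂ] H} (hT : IsSelfAdjoint T)
    (hDT : ∀ k, D.eigenvector k ∈ T.domain)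
    (hfin : traceSq (anticommForm (powerMean ρ α) (centered D T hDT)) ≠ ∞) : T.domain = ⊤ := by
  have hα' : α ∈ Set.Icc (0 : ℝ) 1 := by rcases hα with rfl | rfl <;> simp
  have hρ := D.op_nonneg
  refine domain_eq_top_of_anticomm (S := centered D T hDT) (powerMean_inner ρ α)
    (powerMean_nonneg ρ α) (centered_isFormalAdjoint D (isFormalAdjoint_of_isSelfAdjoint hT) hDT)
    hT.dense_domain (fun y C h => ?_) hfin D.orthonormal hDT
    (fun k => powerMean_apply_of_apply_eq_smul hρ (D.apply_eigenvector k) hα')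
    (fun k => ?_) (fun w hw => ?_)
  · refine mem_domain_of_inner_le hT (C := C + ‖traceWith D T hDT‖ * ‖y‖) fun x => ?_
    have h1 : T x = centered D T hDT x + traceWith D T hDT • (x : H) :=
      eq_add_of_sub_eq (centered_apply D T hDT x.2 x.2).symm
    rw [h1, inner_add_right, inner_smul_right, add_mul]
    refine (norm_add_le _ _).trans (add_le_add (h x) ?_)
    rw [norm_mul, mul_assoc]
    exact mul_le_mul_of_nonneg_left (norm_inner_le_norm _ _) (norm_nonneg _)
  · rw [powerMeanValue_extreme hα]
    linarith [D.nonneg k]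
  · have h0 : ρ w = ((0 : ℝ) : ℂ) • w := by rw [D.apply_eq_zero hw]; simp
    rw [powerMean_apply_of_apply_eq_smul hρ h0 hα', powerMeanValue_extreme hα]
    norm_num

/-- Everywhere defined symmetric operators are bounded (Hellinger–Toeplitz), so Wielandt's argument
applies. -/
theorem false_of_domain_eq_top [Nontrivial H] {X Y : H →ₗ.[ℂ] H} (hX : X.IsFormalAdjoint X)
    (hY : Y.IsFormalAdjoint Y) (hdX : X.domain = ⊤) (hdY : Y.domain = ⊤) {c : ℂ} (hc : c ≠ 0)
    (hXY : ∀ x : (commutator X Y).domain, commutator X Y x = c • (x : H)) : False := by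
  have memX : ∀ x, x ∈ X.domain := fun x => hdX ▸ Submodule.mem_top
  have memY : ∀ x, x ∈ Y.domain := fun x => hdY ▸ Submodule.mem_top
  let LX : H →ₗ[ℂ] H := X.toFun ∘ₗ LinearMap.id.codRestrict X.domain memX
  let LY : H →ₗ[ℂ] H := Y.toFun ∘ₗ LinearMap.id.codRestrict Y.domain memY
  have hLX : LX.IsSymmetric := fun x y => hX ⟨x, memX x⟩ ⟨y, memX y⟩
  have hLY : LY.IsSymmetric := fun x y => hY ⟨x, memY x⟩ ⟨y, memY y⟩
  refine mul_sub_mul_ne_smul_one (⟨LX, hLX.continuous⟩ : H →L[ℂ] H) ⟨LY, hLY.continuous⟩ hc ?_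
  ext x
  exact hXY ⟨x, ⟨⟨memY x, memX _⟩, ⟨memX x, memY _⟩⟩⟩

theorem traceSq_mul_traceSq_ne_zero_of_extreme (D : SpectralDecomposition ι ρ)
    {X Y : H →ₗ.[ℂ] H} (hX : X.IsFormalAdjoint X) (hdX : Dense (X.domain : Set H))
    (hY : Y.IsFormalAdjoint Y) (hdY : Dense (Y.domain : Set H))
    (hDX : ∀ k, D.eigenvector k ∈ X.domain) (hDY : ∀ k, D.eigenvector k ∈ Y.domain)
    {c : ℝ} (hc : ∀ k, (⟪X ⟨_, hDX k⟩, Y ⟨_, hDY k⟩⟫_ℂ).im = c) (hc0 : c ≠ 0)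
    {α : ℝ} (hα : α = 0 ∨ α = 1) :
    traceSq (commForm (powerMean ρ α) (centered D X hDX)) *
        traceSq (anticommForm (powerMean ρ α) (centered D Y hDY)) ≠ 0 := by
  have hα' : α ∈ Set.Icc (0 : ℝ) 1 := by rcases hα with rfl | rfl <;> simp
  obtain ⟨k, hk⟩ : ∃ k, 0 < D.eigenvalue k := by
    by_contra! h
    have h0 : D.eigenvalue = 0 := funext fun k => le_antisymm (h k) (D.nonneg k)
    have h1 := D.hasSum_one
    rw [h0] at h1
    exact one_ne_zero (h1.unique hasSum_zero)
  have h := sq_sum_max_le_traceSq_mul_traceSq D hX hdX hY hdY hDX hDY hc hα'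
    -- This lies halfway between the value 1/2 on ker ρ and the eigenvalue (1 + λ k)/2, so the index
    -- k survives truncation with weight λ k / 4.
    (ε := 1 / 2 + D.eigenvalue k / 4) (by rw [powerMeanValue_extreme hα]; linarith) {k}
  refine (lt_of_lt_of_le (ENNReal.ofReal_pos.2 ?_) h).ne'
  rw [Finset.sum_singleton, powerMeanValue_extreme hα, max_eq_left (by linarith)]
  have h1 : (1 + D.eigenvalue k) / 2 - (1 / 2 + D.eigenvalue k / 4) ≠ 0 := by
    intro h0; linarith
  positivity

theorem le_traceSq_mul_traceSq (D : SpectralDecomposition ι ρ)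
    {X Y : H →ₗ.[ℂ] H} (hX : X.IsFormalAdjoint X) (hdX : Dense (X.domain : Set H))
    (hY : Y.IsFormalAdjoint Y) (hdY : Dense (Y.domain : Set H))
    (hDX : ∀ k, D.eigenvector k ∈ X.domain) (hDY : ∀ k, D.eigenvector k ∈ Y.domain)
    {c : ℝ} (hc : ∀ k, (⟪X ⟨_, hDX k⟩, Y ⟨_, hDY k⟩⟫_ℂ).im = c)
    {α : ℝ} (hα : α ∈ Set.Ioo (0 : ℝ) 1) :
    ENNReal.ofReal ((2 * c) ^ 2) ≤
      traceSq (commForm (powerMean ρ α) (centered D X hDX)) *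
        traceSq (anticommForm (powerMean ρ α) (centered D Y hDY)) := by
  have hG : ∀ G : Finset ι, ENNReal.ofReal ((2 * c * ∑ k ∈ G, D.eigenvalue k) ^ 2) ≤
      traceSq (commForm (powerMean ρ α) (centered D X hDX)) *
        traceSq (anticommForm (powerMean ρ α) (centered D Y hDY)) := by
    -- With G fixed, ε tends to 0 from above; G is enlarged to all of ι only afterwards.
    intro G
    have hcont : Continuous fun ε : ℝ => ENNReal.ofReal
        ((2 * c * ∑ k ∈ G, max (powerMeanValue α (D.eigenvalue k) - ε) 0 ^ 2) ^ 2) :=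
      ENNReal.continuous_ofReal.comp (by fun_prop)
    have ht := (hcont.tendsto 0).mono_left (nhdsWithin_le_nhds (s := Set.Ioi 0))
    have h1 := le_of_tendsto ht (by
      filter_upwards [self_mem_nhdsWithin] with ε hε
      exact sq_sum_max_le_traceSq_mul_traceSq D hX hdX hY hdY hDX hDY hc
        (Set.Ioo_subset_Icc_self hα) (by rwa [powerMeanValue_zero_of_mem_Ioo hα]) G)
    refine le_trans (ENNReal.ofReal_le_ofReal ?_) h1
    rw [mul_pow, mul_pow (2 * c)]
    have h2 : ∑ k ∈ G, D.eigenvalue k ≤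
        ∑ k ∈ G, max (powerMeanValue α (D.eigenvalue k) - 0) 0 ^ 2 := by
      refine Finset.sum_le_sum fun k _ => ?_
      rw [sub_zero, max_eq_left (powerMeanValue_nonneg α (D.nonneg k))]
      exact le_powerMeanValue_sq α (D.nonneg k)
    have h3 : 0 ≤ ∑ k ∈ G, D.eigenvalue k := Finset.sum_nonneg fun k _ => D.nonneg k
    gcongr
  have ht : Filter.Tendsto
      (fun G : Finset ι => ENNReal.ofReal ((2 * c * ∑ k ∈ G, D.eigenvalue k) ^ 2))
      Filter.atTop (nhds (ENNReal.ofReal ((2 * c * 1) ^ 2))) :=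
    (ENNReal.continuous_ofReal.tendsto _).comp
      ((Filter.Tendsto.const_mul (2 * c) D.hasSum_one).pow 2)
  rw [mul_one] at ht
  exact le_of_tendsto' ht hG

end Extreme

/-! ### Combining the two mixed bounds in [0, ∞]. -/

section Assembly

theorem sqrt_mul_sqrt_ge {a b c d e : ℝ≥0∞} (h1 : e ≤ a * d) (h2 : e ≤ c * b) :
    e ≤ (a * b) ^ (1 / 2 : ℝ) * (c * d) ^ (1 / 2 : ℝ) := by
  rw [← ENNReal.mul_rpow_of_nonneg _ _ (by norm_num), mul_mul_mul_comm, mul_comm a c,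
    mul_mul_mul_comm, mul_comm (c * b)]
  calc e = (e * e) ^ (1 / 2 : ℝ) := by
        rw [← sq, ← ENNReal.rpow_natCast, ← ENNReal.rpow_mul]; norm_num
    _ ≤ _ := ENNReal.rpow_le_rpow (mul_le_mul' h1 h2) (by norm_num)

/-- All four factors are nonzero, so one infinite factor is not cancelled by the convention 0 · ∞ =
0. -/
theorem sqrt_mul_sqrt_eq_top {a b c d : ℝ≥0∞} (h1 : a * d ≠ 0) (h2 : c * b ≠ 0)
    (h : b = ∞ ∨ d = ∞) : (a * b) ^ (1 / 2 : ℝ) * (c * d) ^ (1 / 2 : ℝ) = ∞ := by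
  rw [← ENNReal.mul_rpow_of_nonneg _ _ (by norm_num)]
  have ha := left_ne_zero_of_mul h1
  have hd := right_ne_zero_of_mul h1
  have hc := left_ne_zero_of_mul h2
  have hb := right_ne_zero_of_mul h2
  have : a * b * (c * d) = ∞ := by
    rcases h with rfl | rfl
    · rw [ENNReal.mul_top ha, ENNReal.top_mul (mul_ne_zero hc hd)]
    · rw [ENNReal.mul_top hc, ENNReal.mul_top (mul_ne_zero ha hb)]
  rw [this]
  exact ENNReal.top_rpow_of_pos (by norm_num)

end Assembly

end SkewInformation

theorem mainTheorem3 {H : Type*} [NormedAddCommGroup H] [InnerProductSpace ℂ H] [CompleteSpace H]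
    {ι : Type*} (ρ : H →L[ℂ] H) (D : SkewInformation.SpectralDecomposition ι ρ)
    (X Y : H →ₗ.[ℂ] H) (hX : IsSelfAdjoint X) (hY : IsSelfAdjoint Y)
    (hXY : ∀ x : (SkewInformation.commutator X Y).domain,
      SkewInformation.commutator X Y x = (1 / (2 * (Real.pi : ℂ) * Complex.I)) • (x : H))
    (hD : ∀ k, D.eigenvector k ∈ (SkewInformation.commutator X Y).domain)
    (α : ℝ) (hα : α ∈ Set.Icc (0 : ℝ) 1) :
    ENNReal.ofReal
        (1 / 4 * ‖SkewInformation.traceWith D (SkewInformation.commutator X Y) hD‖ ^ 2) ≤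
      SkewInformation.skewW D α X (fun k => SkewInformation.mem_domain_left (hD k)) *
        SkewInformation.skewW D α Y (fun k => SkewInformation.mem_domain_right (hD k)) := by
  open SkewInformation in
  have hX' := isFormalAdjoint_of_isSelfAdjoint hX
  have hY' := isFormalAdjoint_of_isSelfAdjoint hY
  have hDX := fun k => mem_domain_left (hD k)
  have hDY := fun k => mem_domain_right (hD k)
  have hc : ∀ k, (⟪X ⟨_, hDX k⟩, Y ⟨_, hDY k⟩⟫_ℂ).im = -(1 / (4 * Real.pi)) := fun k =>
    im_inner_eq_of_commutator hX' hY' hXY (hD k) (D.orthonormal.1 k)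
  have hc' : ∀ k, (⟪Y ⟨_, hDY k⟩, X ⟨_, hDX k⟩⟫_ℂ).im = 1 / (4 * Real.pi) := fun k => by
    rw [← inner_conj_symm, Complex.conj_im, hc, neg_neg]
  have hπ := Real.pi_pos
  rw [norm_traceWith_commutator D hXY hD]
  by_cases hα' : α ∈ Set.Ioo (0 : ℝ) 1
  · have h1 := le_traceSq_mul_traceSq D hX' hX.dense_domain hY' hY.dense_domain hDX hDY hc hα'
    have h2 := le_traceSq_mul_traceSq D hY' hY.dense_domain hX' hX.dense_domain hDY hDX hc' hα'
    -- The two factors 1/2 come from the definitions of K and L, and |2c| = 1/(2π) is the modulus of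
    -- the trace.
    have e1 : ENNReal.ofReal (1 / 4 * (1 / (2 * Real.pi)) ^ 2) =
        2⁻¹ * 2⁻¹ * ENNReal.ofReal ((2 * (1 / (4 * Real.pi))) ^ 2) := by
      have : (2⁻¹ : ℝ≥0∞) = ENNReal.ofReal 2⁻¹ := by
        rw [ENNReal.ofReal_inv_of_pos two_pos]; simp
      rw [this, ← ENNReal.ofReal_mul (by norm_num), ← ENNReal.ofReal_mul (by norm_num)]
      congr 1
      field_simp
      norm_num
    rw [mul_neg, neg_sq] at h1
    rw [e1]
    refine sqrt_mul_sqrt_ge ?_ ?_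
    · rw [skewK, skewL, mul_mul_mul_comm]
      exact mul_le_mul_right h1 _
    · rw [skewK, skewL, mul_mul_mul_comm]
      exact mul_le_mul_right h2 _
  · have hα2 : α = 0 ∨ α = 1 := by
      rcases hα.1.eq_or_lt with h | h
      · exact Or.inl h.symm
      · rcases hα.2.eq_or_lt with h' | h'
        · exact Or.inr h'
        · exact (hα' ⟨h, h'⟩).elim
    have h0 : (1 / (4 * Real.pi)) ≠ 0 := by positivity
    have h1 := traceSq_mul_traceSq_ne_zero_of_extreme D hX' hX.dense_domain hY' hY.dense_domain
      hDX hDY hc (neg_ne_zero.2 h0) hα2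
    have h2 := traceSq_mul_traceSq_ne_zero_of_extreme D hY' hY.dense_domain hX' hX.dense_domain
      hDY hDX hc' h0 hα2
    have hne : (2⁻¹ : ℝ≥0∞) * 2⁻¹ ≠ 0 := by simp
    refine le_top.trans_eq (sqrt_mul_sqrt_eq_top ?_ ?_ ?_).symm
    · rw [skewK, skewL, mul_mul_mul_comm]
      exact mul_ne_zero hne h1
    · rw [skewK, skewL, mul_mul_mul_comm]
      exact mul_ne_zero hne h2
    · by_contra! hfin
      have hfX : traceSq (anticommForm (powerMean ρ α) (centered D X hDX)) ≠ ∞ := fun h =>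
        hfin.1 (by rw [skewL, h]; exact ENNReal.mul_top (by simp))
      have hfY : traceSq (anticommForm (powerMean ρ α) (centered D Y hDY)) ≠ ∞ := fun h =>
        hfin.2 (by rw [skewL, h]; exact ENNReal.mul_top (by simp))
      have : Nonempty ι := by
        by_contra h
        rw [not_nonempty_iff] at h
        exact one_ne_zero (D.hasSum_one.unique hasSum_empty)
      obtain ⟨k⟩ := this
      have : Nontrivial H := ⟨D.eigenvector k, 0, D.orthonormal.ne_zero k⟩
      exact false_of_domain_eq_top hX' hY' (domain_eq_top_of_traceSq_ne_top D hα2 hX hDX hfX)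
        (domain_eq_top_of_traceSq_ne_top D hα2 hY hDY hfY)
        (one_div_ne_zero (by simp [Real.pi_ne_zero])) hXY
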